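/- Let $H=\tfrac12y^2+\tfrac12ax^2+\tfrac14bx^4$ be one of the three Hamiltonians: (i) global center, $a=b=1$; (ii) truncated pendulum, $a=1$, $b=-1$; (iii) eight loop, $a=-1$, $b=1$. For $\lambda=(\lambda_1,\dots,\lambda_6)\in\mathbb R^6$ let $X_\lambda$ be the planar vector field $$\dot x=H_y,\qquad \dot y=-H_x+(\lambda_1+\lambda_2x^2+\lambda_3y^2+\lambda_4x^4+\lambda_5y^4+\lambda_6x^6)\,y .$$ Let $\Pi$ be an open period annulus of $X_0$, filled by ovals $\{H=h\}$ with $h$ in the interval $I$, where $I=(0,\infty)$ in case (i); $I=(0,\tfrac14)$ in case (ii) (ovals in $|x|<1$); and in case (iii) either $I=(-\tfrac14,0)$ (ovals in $x>0$, or ovals in $x<0$) or $I=(0,\infty)$. Let $I_k(h)=\oint_{H=h}x^k\,y\,dx$ ($k=0,2$) be the integral along the oval of $\Pi$, oriented by $X_0$. Let $\varepsilon\mapsto\lambda(\varepsilon)$, $\lambda_j(\varepsilon)=\sum_{k\ge1}\lambda_{jk}\varepsilon^k$ ($1\le j\le6$), be an analytic arc at $\varepsilon=0$ with $\lambda(0)=0$.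 Choose an analytic cross section to the periodic orbits of $\Pi$, meeting each of them once and parametrized by $h=H$, and let $d(h,\varepsilon)$ be the displacement function (first return map of $X_{\lambda(\varepsilon)}$ minus the identity, in the coordinate $h$). For each $h\in I$ the function $d(h,\cdot)$ is well defined near $\varepsilon=0$ and analytic at $0$, with $d(h,\varepsilon)=M_1(h)\varepsilon+M_2(h)\varepsilon^2+\cdots$. Let $n\ge1$ and let $M_n$ be the first coefficient of this series that does not vanish identically on $I$. Then on $I$ $$M_n(h)=P(h)\,I_2(h)+Q(h)\,I_0(h),$$ where $P,Q$ are real polynomials with $\deg P\le2$, $\deg Q\le2$ if $n=3m$ ($m\ge 1$), and $\deg P\le1$, $\deg Q\le2$ if $3\nmid n$. They are given explicitly by $P=P_n+\lambda_{3m}^3R$, $Q=Q_n+\lambda_{3m}^3S$ if $n=3m$, where $\lambda_{3m}$ is the coefficient of $\varepsilon^m$ in $\lambda_3(\varepsilon)$, and by $P=P_n$, $Q=Q_n$ if $3\nmid n$. Here, in case (i), $$\begin{aligned}P_n&=(\tfrac43\lambda_{6n}-\tfrac{320}{231}\lambda_{5n})h+\tfrac{32}{21}\lambda_{6n}-\tfrac{40}{231}\lambda_{5n}-\tfrac87\lambda_{4n}-\tfrac37\lambda_{3n}+\lambda_{2n},\\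 Q_n&=\tfrac{240}{77}\lambda_{5n}h^2+(-\tfrac{16}{21}\lambda_{6n}+\tfrac{20}{231}\lambda_{5n}+\tfrac47\lambda_{4n}+\tfrac{12}7\lambda_{3n})h+\lambda_{1n},\\ R&=-\tfrac{8}{1001}(308h^2+181h+24),\qquad S=\tfrac{8}{1001}(80h^2+12h);\end{aligned}$$ in case (ii), $$\begin{aligned}P_n&=-(\tfrac43\lambda_{6n}+\tfrac{320}{231}\lambda_{5n})h+\tfrac{32}{21}\lambda_{6n}+\tfrac{40}{231}\lambda_{5n}+\tfrac87\lambda_{4n}-\tfrac37\lambda_{3n}+\lambda_{2n},\\ Q_n&=\tfrac{240}{77}\lambda_{5n}h^2-(\tfrac{16}{21}\lambda_{6n}+\tfrac{20}{231}\lambda_{5n}+\tfrac47\lambda_{4n}-\tfrac{12}7\lambda_{3n})h+\lambda_{1n},\\ R&=-\tfrac{8}{1001}(308h^2-181h+24),\qquad S=-\tfrac{8}{1001}(80h^2-12h);\end{aligned}$$ in case (iii), $$\begin{aligned}P_n&=(\tfrac43\lambda_{6n}+\tfrac{320}{231}\lambda_{5n})h+\tfrac{32}{21}\lambda_{6n}+\tfrac{40}{231}\lambda_{5n}+\tfrac87\lambda_{4n}+\tfrac37\lambda_{3n}+\lambda_{2n},\\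 Q_n&=\tfrac{240}{77}\lambda_{5n}h^2+(\tfrac{16}{21}\lambda_{6n}+\tfrac{20}{231}\lambda_{5n}+\tfrac47\lambda_{4n}+\tfrac{12}7\lambda_{3n})h+\lambda_{1n},\\ R&=-\tfrac{8}{1001}(308h^2+181h+24),\qquad S=-\tfrac{8}{1001}(80h^2+12h).\end{aligned}$$ -/

import Mathlib

open Set Filter Topology Polynomial

noncomputable section

/-- The three Hamiltonians under consideration. -/
inductive HamCase
  | globalCenter
  | truncatedPendulum
  | eightLoop

/-- The open period annuli of the three Hamiltonian systems. The eight loop system has three: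
two bounded ones, one around each center `(1, 0)` and `(-1, 0)`, and the exterior one. -/
inductive PeriodAnnulus
  | globalCenter
  | truncatedPendulum
  | eightRight
  | eightLeft
  | eightExterior

/-- Coefficient `a` of `H = y² / 2 + a x² / 2 + b x⁴ / 4`. -/
def HamCase.a : HamCase → ℝ
  | .globalCenter => 1
  | .truncatedPendulum => 1
  | .eightLoop => -1

/-- Coefficient `b` of `H = y² / 2 + a x² / 2 + b x⁴ / 4`. -/
def HamCase.b : HamCase → ℝ
  | .globalCenter => 1
  | .truncatedPendulum => -1
  | .eightLoop => 1

/-- The Hamiltonian `H(x, y) = y² / 2 + a x² / 2 + b x⁴ / 4`. -/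
def HamCase.ham (c : HamCase) (z : ℝ × ℝ) : ℝ :=
  z.2 ^ 2 / 2 + c.a * z.1 ^ 2 / 2 + c.b * z.1 ^ 4 / 4

/-- The planar vector field `X_l`:
`x' = H_y = y`,
`y' = -H_x + (l₁ + l₂ x² + l₃ y² + l₄ x⁴ + l₅ y⁴ + l₆ x⁶) y`, where `-H_x = -(a x + b x³)`.
The parameter `l_j` of the usual numbering `j = 1, …, 6` is `l (j - 1)`. -/
def HamCase.field (c : HamCase) (l : Fin 6 → ℝ) (z : ℝ × ℝ) : ℝ × ℝ :=
  (z.2,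
    -(c.a * z.1 + c.b * z.1 ^ 3) +
      (l 0 + l 1 * z.1 ^ 2 + l 2 * z.2 ^ 2 + l 3 * z.1 ^ 4 + l 4 * z.2 ^ 4 + l 5 * z.1 ^ 6) * z.2)

namespace PeriodAnnulus

/-- The Hamiltonian to which a period annulus belongs. -/
def hamCase : PeriodAnnulus → HamCase
  | .globalCenter => .globalCenter
  | .truncatedPendulum => .truncatedPendulum
  | .eightRight => .eightLoop
  | .eightLeft => .eightLoop
  | .eightExterior => .eightLoop

/-- The open interval of levels `h` filling the annulus. -/
def levels : PeriodAnnulus → Set ℝ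
  | .globalCenter => Ioi 0
  | .truncatedPendulum => Ioo 0 (1 / 4)
  | .eightRight => Ioo (-1 / 4) 0
  | .eightLeft => Ioo (-1 / 4) 0
  | .eightExterior => Ioi 0

/-- The vertical strip that singles out the annulus among the points with admissible level. In the
truncated pendulum case the levels in `(0, 1/4)` also have unbounded branches, in `|x| > 1`. -/
def strip : PeriodAnnulus → Set ℝ
  | .globalCenter => univ
  | .truncatedPendulum => Ioo (-1) 1
  | .eightRight => Ioi 0
  | .eightLeft => Iio 0
  | .eightExterior => univ

/-- The oval `{H = h}` of the annulus. -/
def oval (A : PeriodAnnulus) (h : ℝ) : Set (ℝ × ℝ) :=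
  {z | z.1 ∈ A.strip ∧ A.hamCase.ham z = h}

/-- `γ`, on `[0, T]`, runs exactly once through the oval `{H = h}` of the annulus, as a periodic
orbit of the Hamiltonian system `X_0` (in particular with the orientation given by `X_0`). -/
def IsOvalParam (A : PeriodAnnulus) (h : ℝ) (γ : ℝ → ℝ × ℝ) (T : ℝ) : Prop :=
  0 < T ∧ (∀ t, HasDerivAt γ (A.hamCase.field 0 (γ t)) t) ∧ γ T = γ 0 ∧
    InjOn γ (Ico 0 T) ∧ γ '' Ico 0 T = A.oval h

/-- An analytic cross section to the periodic orbits of the annulus, meeting each oval in one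
point and parametrized by the level of the Hamiltonian. Transversality to `X_0` is automatic, since
`dH (σ' h) = 1`. -/
def IsCrossSection (A : PeriodAnnulus) (σ : ℝ → ℝ × ℝ) : Prop :=
  AnalyticOnNhd ℝ σ A.levels ∧ ∀ h ∈ A.levels, σ h ∈ A.oval h

end PeriodAnnulus

/-- The forward orbit of `X_l` starting at `p` meets the set `S` at positive times, and does so for
the first time at the point `q`. -/
def IsFirstReturn (c : HamCase) (l : Fin 6 → ℝ) (S : Set (ℝ × ℝ)) (p q : ℝ × ℝ) : Prop :=
  ∃ T : ℝ, 0 < T ∧ ∃ γ : ℝ → ℝ × ℝ,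
    (∀ t ∈ Icc 0 T, HasDerivWithinAt γ (c.field l (γ t)) (Icc 0 T) t) ∧
    γ 0 = p ∧ γ T = q ∧ q ∈ S ∧ ∀ t ∈ Ioo 0 T, γ t ∉ S

/-- `δ = k - h`, where the first return map of `X_l` on the cross section `σ` (parametrized by the
level of `H`) sends `h` to `k`. -/
def IsDisplacement (A : PeriodAnnulus) (σ : ℝ → ℝ × ℝ) (l : Fin 6 → ℝ) (h δ : ℝ) : Prop :=
  ∃ k ∈ A.levels, IsFirstReturn A.hamCase l (σ '' A.levels) (σ h) (σ k) ∧ δ = k - h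

open Classical in
/-- The displacement function `d(h)` of `X_l` on the cross section `σ` (set to `0` if the orbit
through `σ h` does not return). -/
def displacement (A : PeriodAnnulus) (σ : ℝ → ℝ × ℝ) (l : Fin 6 → ℝ) (h : ℝ) : ℝ :=
  if hd : ∃ δ, IsDisplacement A σ l h δ then hd.choose else 0

/-- The coefficient of `ε ^ k` in the Taylor expansion of `f` at `0`. -/
def taylorCoeff (f : ℝ → ℝ) (k : ℕ) : ℝ := iteratedDeriv k f 0 / (k.factorial : ℝ)

/-- The coefficient `M_k(h)` of `ε ^ k` in the expansion of the displacement function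
`d(h, ε)` of the deformation `X_{lam(ε)}`. -/
def melnikov (A : PeriodAnnulus) (σ : ℝ → ℝ × ℝ) (lam : ℝ → Fin 6 → ℝ) (k : ℕ) (h : ℝ) : ℝ :=
  taylorCoeff (fun ε => displacement A σ (lam ε) h) k

/-- The coefficient vector of `ε ^ k` in the arc: `λ_{jk}` is `arcCoeff lam k (j - 1)`. -/
def arcCoeff (lam : ℝ → Fin 6 → ℝ) (k : ℕ) (j : Fin 6) : ℝ := taylorCoeff (fun ε => lam ε j) k

/-- The line integral `∮ x ^ k y dx` along `γ` restricted to `[0, T]`. -/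
def ovalIntegral (k : ℕ) (γ : ℝ → ℝ × ℝ) (T : ℝ) : ℝ :=
  ∫ t in (0 : ℝ)..T, (γ t).1 ^ k * (γ t).2 * deriv (fun s => (γ s).1) t

/-- The part of the coefficient of `I_2` that is linear in `l = (λ_{1n}, …, λ_{6n})`. -/
def linP (c : HamCase) (l : Fin 6 → ℝ) : ℝ[X] :=
  match c with
  | .globalCenter =>
      C (4 / 3 * l 5 - 320 / 231 * l 4) * X
        + C (32 / 21 * l 5 - 40 / 231 * l 4 - 8 / 7 * l 3 - 3 / 7 * l 2 + l 1)
  | .truncatedPendulum =>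
      C (-(4 / 3 * l 5 + 320 / 231 * l 4)) * X
        + C (32 / 21 * l 5 + 40 / 231 * l 4 + 8 / 7 * l 3 - 3 / 7 * l 2 + l 1)
  | .eightLoop =>
      C (4 / 3 * l 5 + 320 / 231 * l 4) * X
        + C (32 / 21 * l 5 + 40 / 231 * l 4 + 8 / 7 * l 3 + 3 / 7 * l 2 + l 1)

/-- The part of the coefficient of `I_0` that is linear in `l = (λ_{1n}, …, λ_{6n})`. -/
def linQ (c : HamCase) (l : Fin 6 → ℝ) : ℝ[X] :=
  match c with
  | .globalCenter =>
      C (240 / 77 * l 4) * X ^ 2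
        + C (-16 / 21 * l 5 + 20 / 231 * l 4 + 4 / 7 * l 3 + 12 / 7 * l 2) * X + C (l 0)
  | .truncatedPendulum =>
      C (240 / 77 * l 4) * X ^ 2
        + C (-(16 / 21 * l 5 + 20 / 231 * l 4 + 4 / 7 * l 3 - 12 / 7 * l 2)) * X + C (l 0)
  | .eightLoop =>
      C (240 / 77 * l 4) * X ^ 2
        + C (16 / 21 * l 5 + 20 / 231 * l 4 + 4 / 7 * l 3 + 12 / 7 * l 2) * X + C (l 0)

/-- The polynomial multiplying `λ_{3m}³ I_2` when `n = 3m`. -/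
def cubP (c : HamCase) : ℝ[X] :=
  match c with
  | .globalCenter => C (-8 / 1001) * (C 308 * X ^ 2 + C 181 * X + C 24)
  | .truncatedPendulum => C (-8 / 1001) * (C 308 * X ^ 2 - C 181 * X + C 24)
  | .eightLoop => C (-8 / 1001) * (C 308 * X ^ 2 + C 181 * X + C 24)

/-- The polynomial multiplying `λ_{3m}³ I_0` when `n = 3m`. -/
def cubQ (c : HamCase) : ℝ[X] :=
  match c with
  | .globalCenter => C (8 / 1001) * (C 80 * X ^ 2 + C 12 * X)
  | .truncatedPendulum => C (-8 / 1001) * (C 80 * X ^ 2 - C 12 * X)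
  | .eightLoop => C (-8 / 1001) * (C 80 * X ^ 2 + C 12 * X)

/-- The coefficient of `I_2` in the Melnikov function of order `n`. -/
def polyP (c : HamCase) (lam : ℝ → Fin 6 → ℝ) (n : ℕ) : ℝ[X] :=
  linP c (arcCoeff lam n) + if 3 ∣ n then C (arcCoeff lam (n / 3) 2 ^ 3) * cubP c else 0

/-- The coefficient of `I_0` in the Melnikov function of order `n`. -/
def polyQ (c : HamCase) (lam : ℝ → Fin 6 → ℝ) (n : ℕ) : ℝ[X] :=
  linQ c (arcCoeff lam n) + if 3 ∣ n then C (arcCoeff lam (n / 3) 2 ^ 3) * cubQ c else 0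

end

/-! Write f_λ for the factor of y in the perturbation. Along an orbit of `X_λ` one has dH = f_λ y
dx, so the displacement is the integral of f_λ y dx up to the first return. At first order this is
an integral over the oval. Modulo exact forms such as d(xy³) and d(x³y³), and with H = h, it reduces
to I_2 and I_0 with coefficients `linP` and `linQ` (`IsSol.integral_damp`). These have five
coefficients in six parameters. Their common kernel is the line spanned by `exactDir`, where the
form ω = f y dx equals dF₁ + q dH with F₁ = xy³, q = -3xy.

Along this line Françoise's recursion continues: qω = dF₂ + (q² + q₂) dH, so order two contributes
nothing. Order three gives ∮ (q² + q₂) ω, which reduces to `cubP` and `cubQ`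
(`IsSol.integral_cubic`). `IsSol.ham_sub_ham` condenses the recursion into one exact identity for l
= β + s • exactDir. With β = ε^n B and s = ε^m u, n ≤ 3m, it gives M_n: a part linear in B(0) and,
when n = 3m, a part proportional to u(0)³ (`melnikov_eq`).

That a vanishing M_k forces the arc into this shape is an induction
(`isExactBelow_of_melnikov_eq_zero`). It needs I_2 and I_0 to be independent over polynomials of
degree at most two (`coeffs_eq_zero_of_integral_relation`): the Picard–Fuchs system makes I_2/I_0 a
solution of a Riccati equation, and `riccati_no_solution` excludes -Q/P. Since `cubP` has degree two
and `linP` at most one, the cubic coefficient must vanish; then the linear part lies in the kernel.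

Analyticity of the displacement comes from the implicit function theorem, used twice: for the
integral equation of the flow, which is polynomial on the Banach algebra C([0,1]) (`exists_flow`),
and for the transversal hitting of the section (`exists_local_return`, `exists_first_return`). -/

noncomputable section

open scoped ContDiff

/-! ### Paths as elements of a Banach algebra, and their primitives -/

/-- The point of the unit interval nearest to `t`. -/
abbrev toUnit (t : ℝ) : unitInterval := projIcc 0 1 zero_le_one t

/-- The pairs of coordinates of the paths in the plane. -/
abbrev PlanePath : Type := C(unitInterval, ℝ) × C(unitInterval, ℝ)

theorem continuous_comp_toUnit (u : C(unitInterval, ℝ)) : Continuous fun t => u (toUnit t) :=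
  u.continuous.comp continuous_projIcc

/-- The primitive vanishing at `0`, as an operator on `C([0, 1])`. -/
def primitive : C(unitInterval, ℝ) →L[ℝ] C(unitInterval, ℝ) :=
  LinearMap.mkContinuous
    { toFun := fun u => ⟨fun s => ∫ r in (0 : ℝ)..s, u (toUnit r),
        (intervalIntegral.continuous_primitive
          (fun a b => (continuous_comp_toUnit u).intervalIntegrable a b) 0).comp
            continuous_subtype_val⟩
      map_add' := fun u v => by
        ext s
        simpa using intervalIntegral.integral_add
          ((continuous_comp_toUnit u).intervalIntegrable 0 (s : ℝ))
          ((continuous_comp_toUnit v).intervalIntegrable 0 (s : ℝ))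
      map_smul' := fun c u => by
        ext s
        simp }
    1 fun u => by
      rw [one_mul]
      refine (ContinuousMap.norm_le _ (norm_nonneg u)).2 fun s => ?_
      have := intervalIntegral.norm_integral_le_of_norm_le_const (a := (0 : ℝ)) (b := s)
        (f := fun r => u (toUnit r)) (C := ‖u‖) fun r _ => u.norm_coe_le_norm _
      refine this.trans ?_
      rw [sub_zero, abs_of_nonneg s.2.1]
      exact mul_le_of_le_one_right (norm_nonneg u) s.2.2

theorem primitive_apply (u : C(unitInterval, ℝ)) (s : unitInterval) :
    primitive u s = ∫ r in (0 : ℝ)..s, u (toUnit r) := rfl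

theorem primitive_zero (u : C(unitInterval, ℝ)) : primitive u 0 = 0 := by
  simp [primitive_apply]

/-- The path `u'` is the derivative of `u` on `[0, 1]`. -/
def PathDeriv (u u' : C(unitInterval, ℝ)) : Prop :=
  ∀ s : unitInterval, HasDerivWithinAt (fun t => u (toUnit t)) (u' s) (Icc 0 1) s

theorem toUnit_coe (s : unitInterval) : toUnit s = s := projIcc_val _ _

namespace PathDeriv

variable {u u' v v' : C(unitInterval, ℝ)}

theorem congr_right (h : PathDeriv u u') (e : u' = v') : PathDeriv u v' := e ▸ h

theorem add (h : PathDeriv u u') (k : PathDeriv v v') : PathDeriv (u + v) (u' + v') := fun s => by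
  simpa using (h s).fun_add (k s)

theorem mul (h : PathDeriv u u') (k : PathDeriv v v') :
    PathDeriv (u * v) (u' * v + u * v') := fun s => by
  simpa [toUnit_coe] using (h s).fun_mul (k s)

theorem pow (h : PathDeriv u u') (n : ℕ) :
    PathDeriv (u ^ n) ((n : ℝ) • (u ^ (n - 1) * u')) := fun s => by
  simpa [toUnit_coe, mul_assoc] using (h s).fun_pow n

end PathDeriv

theorem pathDeriv_const (c : ℝ) : PathDeriv (c • 1) 0 := fun s => by
  simpa using hasDerivWithinAt_const (s : ℝ) (Icc 0 1) c

theorem pathDeriv_primitive (u : C(unitInterval, ℝ)) : PathDeriv (primitive u) u := fun s => by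
  have h : HasDerivAt (fun t : ℝ => ∫ r in (0 : ℝ)..t, u (toUnit r)) (u (toUnit s)) s :=
    intervalIntegral.integral_hasDerivAt_right
      ((continuous_comp_toUnit u).intervalIntegrable _ _)
      ((continuous_comp_toUnit u).stronglyMeasurableAtFilter _ _)
      (continuous_comp_toUnit u).continuousAt
  rw [toUnit_coe] at h
  refine h.hasDerivWithinAt.congr_of_mem (fun t ht => ?_) s.2
  rw [primitive_apply, toUnit, projIcc_of_mem _ ht]

/-- The fundamental theorem of calculus. It trades differential equations for equations between
elements of C([0,1]), which can be differentiated in the path itself. -/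
theorem PathDeriv.eq_primitive {u u' : C(unitInterval, ℝ)} (h : PathDeriv u u') :
    u = u 0 • 1 + primitive u' := by
  ext s
  have key : ∫ r in (0 : ℝ)..s, u' (toUnit r) = u (toUnit s) - u (toUnit 0) := by
    refine intervalIntegral.integral_eq_sub_of_hasDerivAt_of_le s.2.1
      (continuous_comp_toUnit u).continuousOn (fun t ht => ?_)
      ((continuous_comp_toUnit u').intervalIntegrable _ _)
    have ht1 : t ∈ Ioo (0 : ℝ) 1 := ⟨ht.1, ht.2.trans_le s.2.2⟩
    have := (h ⟨t, Ioo_subset_Icc_self ht1⟩).hasDerivAt (Icc_mem_nhds ht1.1 ht1.2)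
    rwa [toUnit, projIcc_of_mem _ (Ioo_subset_Icc_self ht1)]
  simp [primitive_apply, key]

theorem pathDeriv_iff {u u' : C(unitInterval, ℝ)} : PathDeriv u u' ↔ u = u 0 • 1 + primitive u' :=
  ⟨PathDeriv.eq_primitive, fun h => by
    rw [h]
    simpa using (pathDeriv_const (u 0)).add (pathDeriv_primitive u')⟩

/-- The integral over `[0, 1]`. -/
def integral01 : C(unitInterval, ℝ) →L[ℝ] ℝ :=
  (ContinuousMap.evalCLM ℝ (1 : unitInterval)).comp primitive

theorem integral01_apply (u : C(unitInterval, ℝ)) :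
    integral01 u = ∫ r in (0 : ℝ)..1, u (toUnit r) := by
  simp [integral01, primitive_apply]

theorem PathDeriv.integral01_eq {u u' : C(unitInterval, ℝ)} (h : PathDeriv u u') :
    integral01 u' = u 1 - u 0 := by
  have := congrArg (fun f : C(unitInterval, ℝ) => f 1) h.eq_primitive
  simp only [ContinuousMap.add_apply, ContinuousMap.smul_apply, ContinuousMap.one_apply] at this
  rw [this]
  simp [integral01]

/-! ### Invertibility of linear Volterra equations -/

/-- The exponential weight `s ↦ exp (L s)`. -/
def expWeight (L : ℝ) : C(unitInterval, ℝ) := ⟨fun s => Real.exp (L * s), by fun_prop⟩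

theorem expWeight_mul_neg (L : ℝ) : expWeight L * expWeight (-L) = 1 := by
  ext s
  simp [expWeight, ← Real.exp_add]

/-- Bielecki's trick: the integral of exp(Lr) up to s is at most exp(Ls)/L, so conjugating by the
weight makes integration as small as desired. -/
theorem norm_weighted_primitive_le {L : ℝ} (hL : 0 < L) (u : C(unitInterval, ℝ)) :
    ‖expWeight (-L) * primitive (expWeight L * u)‖ ≤ L⁻¹ * ‖u‖ := by
  refine (ContinuousMap.norm_le _ (by positivity)).2 fun s => ?_
  have hint : ∫ r in (0 : ℝ)..s, Real.exp (L * r) = (Real.exp (L * s) - 1) / L := by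
    have : ∀ t ∈ uIcc (0 : ℝ) s, HasDerivAt (fun r => Real.exp (L * r) / L) (Real.exp (L * t)) t := by
      intro t _
      have := ((hasDerivAt_id t).const_mul L).exp.div_const L
      simpa [hL.ne'] using this
    rw [intervalIntegral.integral_eq_sub_of_hasDerivAt this
      ((by fun_prop : Continuous fun r => Real.exp (L * r)).intervalIntegrable _ _)]
    simp [sub_div]
  have hb : ‖primitive (expWeight L * u) s‖ ≤ ‖u‖ * ((Real.exp (L * s) - 1) / L) := by
    rw [primitive_apply, ← hint, ← intervalIntegral.integral_const_mul]
    refine intervalIntegral.norm_integral_le_of_norm_le s.2.1 ?_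
      ((by fun_prop : Continuous fun r => ‖u‖ * Real.exp (L * r)).intervalIntegrable _ _)
    refine Filter.Eventually.of_forall fun r hr => ?_
    have hr' : r ∈ Icc (0 : ℝ) 1 := ⟨hr.1.le, hr.2.trans s.2.2⟩
    have e : toUnit r = ⟨r, hr'⟩ := projIcc_of_mem _ hr'
    rw [e, ContinuousMap.mul_apply, norm_mul, mul_comm]
    refine mul_le_mul (u.norm_coe_le_norm _) (le_of_eq ?_) (norm_nonneg _) (norm_nonneg _)
    simp [expWeight]
  rw [ContinuousMap.mul_apply, norm_mul]
  have he : ‖expWeight (-L) s‖ = Real.exp (-L * s) := by simp [expWeight]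
  rw [he]
  calc Real.exp (-L * s) * ‖primitive (expWeight L * u) s‖
      ≤ Real.exp (-L * s) * (‖u‖ * ((Real.exp (L * s) - 1) / L)) := by gcongr
    _ = L⁻¹ * ‖u‖ * (1 - Real.exp (-L * s)) := by
        have : Real.exp (-(L * s)) * Real.exp (L * s) = 1 := by simp [← Real.exp_add]
        rw [neg_mul]
        field_simp
        linear_combination ‖u‖ * this
    _ ≤ L⁻¹ * ‖u‖ := mul_le_of_le_one_right (by positivity)
        (by linarith [Real.exp_pos (-L * s)])

/-- The Volterra operator `(δx, δy) ↦ ∫ M (δx, δy)` of a linear system with coefficients in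
`C([0, 1])`. -/
def volterra (m₁₁ m₁₂ m₂₁ m₂₂ : C(unitInterval, ℝ)) :
    PlanePath →L[ℝ] PlanePath :=
  let mul := ContinuousLinearMap.mul ℝ C(unitInterval, ℝ)
  let p₁ := ContinuousLinearMap.fst ℝ C(unitInterval, ℝ) C(unitInterval, ℝ)
  let p₂ := ContinuousLinearMap.snd ℝ C(unitInterval, ℝ) C(unitInterval, ℝ)
  (primitive ∘L (mul m₁₁ ∘L p₁ + mul m₁₂ ∘L p₂)).prod
    (primitive ∘L (mul m₂₁ ∘L p₁ + mul m₂₂ ∘L p₂))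

theorem volterra_apply (m₁₁ m₁₂ m₂₁ m₂₂ : C(unitInterval, ℝ)) (u : PlanePath) :
    volterra m₁₁ m₁₂ m₂₁ m₂₂ u =
      (primitive (m₁₁ * u.1 + m₁₂ * u.2), primitive (m₂₁ * u.1 + m₂₂ * u.2)) := rfl

/-- Multiplication of both components by an exponential weight. -/
def weightEquiv (L : ℝ) : PlanePath ≃L[ℝ] PlanePath :=
  ContinuousLinearEquiv.equivOfInverse
    (((ContinuousLinearMap.mul ℝ C(unitInterval, ℝ) (expWeight L))).prodMap
      ((ContinuousLinearMap.mul ℝ C(unitInterval, ℝ) (expWeight L))))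
    (((ContinuousLinearMap.mul ℝ C(unitInterval, ℝ) (expWeight (-L)))).prodMap
      ((ContinuousLinearMap.mul ℝ C(unitInterval, ℝ) (expWeight (-L)))))
    (fun u => by
      have := expWeight_mul_neg (-L)
      rw [neg_neg] at this
      ext1 <;> simp [← mul_assoc, this])
    (fun u => by
      have := expWeight_mul_neg L
      ext1 <;> simp [← mul_assoc, this])

/-- No smallness of the coefficients is needed: the Volterra operator is conjugate, through the
weight, to one of norm less than 1, to which the Neumann series applies. -/
theorem isInvertible_id_sub_volterra (m₁₁ m₁₂ m₂₁ m₂₂ : C(unitInterval, ℝ)) :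
    (ContinuousLinearMap.id ℝ _ - volterra m₁₁ m₁₂ m₂₁ m₂₂).IsInvertible := by
  set c : ℝ := ‖m₁₁‖ + ‖m₁₂‖ + ‖m₂₁‖ + ‖m₂₂‖ with hc
  have hc0 : 0 ≤ c := by positivity
  -- The conjugated operator has norm at most c/L, so any L > c would do.
  set L : ℝ := c + 1
  have hL : 0 < L := by positivity
  set K := volterra m₁₁ m₁₂ m₂₁ m₂₂
  set W := weightEquiv L
  set K' : PlanePath →L[ℝ] PlanePath :=
    (W.symm : PlanePath →L[ℝ] _) ∘L K ∘L (W : PlanePath →L[ℝ] _) with hK'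
  have hK'a : ∀ u, K' u = (expWeight (-L) * primitive (expWeight L * (m₁₁ * u.1 + m₁₂ * u.2)),
      expWeight (-L) * primitive (expWeight L * (m₂₁ * u.1 + m₂₂ * u.2))) := by
    intro u
    have : W u = (expWeight L * u.1, expWeight L * u.2) := rfl
    rw [hK', ContinuousLinearMap.comp_apply, ContinuousLinearMap.comp_apply]
    change W.symm (K (W u)) = _
    rw [this, volterra_apply]
    change (expWeight (-L) * _, expWeight (-L) * _) = _
    have e : ∀ m m' : C(unitInterval, ℝ), m * (expWeight L * u.1) + m' * (expWeight L * u.2) =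
        expWeight L * (m * u.1 + m' * u.2) := fun m m' => by ring
    rw [e, e]
    rfl
  have hb : ∀ (m m' : C(unitInterval, ℝ)) (u : PlanePath), ‖m‖ + ‖m'‖ ≤ c →
      ‖expWeight (-L) * primitive (expWeight L * (m * u.1 + m' * u.2))‖ ≤ L⁻¹ * c * ‖u‖ := by
    intro m m' u hm
    refine (norm_weighted_primitive_le hL _).trans ?_
    rw [mul_assoc]
    refine mul_le_mul_of_nonneg_left ?_ (by positivity)
    calc ‖m * u.1 + m' * u.2‖ ≤ ‖m‖ * ‖u.1‖ + ‖m'‖ * ‖u.2‖ :=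
          (norm_add_le _ _).trans (add_le_add (norm_mul_le _ _) (norm_mul_le _ _))
      _ ≤ ‖m‖ * ‖u‖ + ‖m'‖ * ‖u‖ := by
          gcongr
          · exact norm_fst_le u
          · exact norm_snd_le u
      _ ≤ c * ‖u‖ := by rw [← add_mul]; gcongr
  have hnorm : ‖K'‖ < 1 := by
    refine lt_of_le_of_lt (ContinuousLinearMap.opNorm_le_bound _
      (by positivity : 0 ≤ L⁻¹ * c) fun u => ?_) (?_ : L⁻¹ * c < 1)
    · rw [hK'a]
      refine max_le (hb _ _ _ ?_) (hb _ _ _ ?_)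
      · linarith [norm_nonneg m₂₁, norm_nonneg m₂₂]
      · linarith [norm_nonneg m₁₁, norm_nonneg m₁₂]
    · rw [inv_mul_lt_iff₀ hL]
      simp [L]
  have hinv : (ContinuousLinearMap.id ℝ _ - K').IsInvertible := by
    refine ContinuousLinearMap.IsInvertible.of_inverse
      (g := ((Units.oneSub K' hnorm)⁻¹ : (PlanePath →L[ℝ] _)ˣ)) ?_ ?_
    · exact (Units.oneSub K' hnorm).mul_inv
    · exact (Units.oneSub K' hnorm).inv_mul
  have heq : ContinuousLinearMap.id ℝ _ - K =
      (W : PlanePath →L[ℝ] _) ∘L (ContinuousLinearMap.id ℝ _ - K') ∘L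
        (W.symm : PlanePath →L[ℝ] _) := by
    refine ContinuousLinearMap.ext fun u => ?_
    simp [hK']
  rw [heq]
  exact ContinuousLinearMap.IsInvertible.comp ⟨W, rfl⟩ (hinv.comp ⟨W.symm, rfl⟩)

/-! ### The flow as an analytic function of time, starting point and parameters -/

/-- The second component of `X_l` along a path. -/
def fieldPath (c : HamCase) (l : Fin 6 → ℝ) (x y : C(unitInterval, ℝ)) : C(unitInterval, ℝ) :=
  -(c.a • x + c.b • x ^ 3) +
    (l 0 • 1 + l 1 • x ^ 2 + l 2 • y ^ 2 + l 3 • x ^ 4 + l 4 • y ^ 4 + l 5 • x ^ 6) * y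

/-- The value of a planar path. -/
def pathEval (g : PlanePath) (s : unitInterval) : ℝ × ℝ := (g.1 s, g.2 s)

theorem field_pathEval (c : HamCase) (l : Fin 6 → ℝ) (g : PlanePath) (s : unitInterval) :
    c.field l (pathEval g s) = (g.2 s, fieldPath c l g.1 g.2 s) := by
  simp [HamCase.field, pathEval, fieldPath]

/-- `g` solves on `[0, 1]` the equation of `X_l` with time rescaled by `T`, and starts at `z`. -/
structure IsSol (c : HamCase) (T : ℝ) (z : ℝ × ℝ) (l : Fin 6 → ℝ) (g : PlanePath) :
    Prop where
  start : pathEval g 0 = z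
  deriv_fst : PathDeriv g.1 (T • g.2)
  deriv_snd : PathDeriv g.2 (T • fieldPath c l g.1 g.2)

/-- The integral equation whose zeros are the solutions `IsSol`. -/
def flowEq (c : HamCase) (v : (ℝ × ((ℝ × ℝ) × (Fin 6 → ℝ))) × PlanePath) :
    PlanePath :=
  (v.2.1 - (v.1.2.1.1 • 1 + v.1.1 • primitive v.2.2),
    v.2.2 - (v.1.2.1.2 • 1 + v.1.1 • primitive (fieldPath c v.1.2.2 v.2.1 v.2.2)))

theorem flowEq_eq_zero_iff {c : HamCase} {T : ℝ} {z : ℝ × ℝ} {l : Fin 6 → ℝ}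
    {g : PlanePath} : flowEq c ((T, (z, l)), g) = 0 ↔ IsSol c T z l g := by
  simp only [flowEq, Prod.mk_eq_zero, sub_eq_zero]
  constructor
  · rintro ⟨h1, h2⟩
    have e1 : g.1 0 = z.1 := by
      have := congrArg (fun u : C(unitInterval, ℝ) => u 0) h1
      simpa [primitive_zero] using this
    have e2 : g.2 0 = z.2 := by
      have := congrArg (fun u : C(unitInterval, ℝ) => u 0) h2
      simpa [primitive_zero] using this
    refine ⟨Prod.ext e1 e2, pathDeriv_iff.2 ?_, pathDeriv_iff.2 ?_⟩
    · rw [e1, map_smul]; exact h1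
    · rw [e2, map_smul]; exact h2
  · rintro ⟨h0, h1, h2⟩
    have h1 := h1.eq_primitive
    have h2 := h2.eq_primitive
    rw [map_smul] at h1 h2
    rw [← h0]
    exact ⟨h1, h2⟩

/-- The equation is polynomial in the numbers and in the paths, up to the bounded operator
`primitive`. -/
theorem contDiff_flowEq (c : HamCase) : ContDiff ℝ ω (flowEq c) := by
  unfold flowEq fieldPath
  fun_prop

/-- The Volterra operator is that of the variational equation x' = T y, y' = -T (a + 3 b x²) y-free
in its last entry. The value 0 of the parameters suffices, because the implicit function theorem is
applied only at unperturbed orbits. -/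
theorem hasFDerivAt_flowEq (c : HamCase) (T : ℝ) (z : ℝ × ℝ) (g : PlanePath) :
    HasFDerivAt (fun g => flowEq c ((T, (z, 0)), g))
      (ContinuousLinearMap.id ℝ _ -
        volterra 0 (T • 1) (-(T • (c.a • 1 + (3 * c.b) • g.1 ^ 2))) 0) g := by
  have h1 : HasFDerivAt (fun g : PlanePath => g.1)
    (ContinuousLinearMap.fst ℝ C(unitInterval, ℝ) C(unitInterval, ℝ)) g := hasFDerivAt_fst
  have h2 : HasFDerivAt (fun g : PlanePath => g.2)
    (ContinuousLinearMap.snd ℝ C(unitInterval, ℝ) C(unitInterval, ℝ)) g := hasFDerivAt_snd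
  have h3 := ((h1.const_smul c.a).add ((h1.pow 3).const_smul c.b)).neg
  have h4 := h1.sub (((primitive.hasFDerivAt.comp g h2).const_smul T).const_add (z.1 • 1))
  have h5 := h2.sub (((primitive.hasFDerivAt.comp g h3).const_smul T).const_add (z.2 • 1))
  have h6 := h4.prodMk h5
  refine (h6.congr_of_eventuallyEq (Eventually.of_forall fun g => ?_)).congr_fderiv ?_
  · simp [flowEq, fieldPath]
  · refine ContinuousLinearMap.ext fun u => ?_
    ext1
    · simp [volterra_apply]
    · simp only [sub_apply, volterra_apply]
      simp
      simp only [← map_smul, ← map_neg, ← map_add]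
      congr 1
      ext s
      have e : (3 : C(unitInterval, ℝ)) s = 3 := rfl
      simp [e]
      ring

/-- Rescaling time to [0,1] makes T a parameter like the others, so one application of the analytic
implicit function theorem gives joint analyticity of the whole path. -/
theorem exists_flow {c : HamCase} {T : ℝ} {z : ℝ × ℝ} {g : PlanePath}
    (hg : IsSol c T z 0 g) :
    ∃ Γ : ℝ × ((ℝ × ℝ) × (Fin 6 → ℝ)) → PlanePath,
      AnalyticAt ℝ Γ (T, (z, 0)) ∧ Γ (T, (z, 0)) = g ∧
        ∀ᶠ q in 𝓝 (T, (z, (0 : Fin 6 → ℝ))), IsSol c q.1 q.2.1 q.2.2 (Γ q) := by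
  set u : (ℝ × ((ℝ × ℝ) × (Fin 6 → ℝ))) × PlanePath := ((T, (z, 0)), g) with hu
  have hcd : ContDiffAt ℝ ω (flowEq c) u := (contDiff_flowEq c).contDiffAt
  have hinv : (fderiv ℝ (flowEq c) u ∘L .inr ℝ _ _).IsInvertible := by
    have h1 : HasFDerivAt (fun g => flowEq c ((T, (z, 0)), g)) (fderiv ℝ (flowEq c) u ∘L .inr ℝ _ _)
        g := (hcd.differentiableAt (by simp)).hasFDerivAt.comp g (hasFDerivAt_prodMk_right _ _)
    rw [h1.unique (hasFDerivAt_flowEq c T z g)]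
    exact isInvertible_id_sub_volterra _ _ _ _
  refine ⟨hcd.implicitFunction (by simp) hinv, ?_, hcd.implicitFunction_apply_self _ _, ?_⟩
  · exact (hcd.contDiffAt_implicitFunction (by simp) hinv).analyticAt
  · filter_upwards [hcd.eventually_apply_implicitFunction (by simp) hinv] with q hq
    exact flowEq_eq_zero_iff.1 (hq.trans (flowEq_eq_zero_iff.2 hg))

/-! ### Uniqueness of solutions and change of time -/

theorem ode_unique_Icc {v : ℝ × ℝ → ℝ × ℝ} (hv : ContDiff ℝ 1 v) {T : ℝ} {γ δ : ℝ → ℝ × ℝ}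
    (hγ : ∀ t ∈ Icc 0 T, HasDerivWithinAt γ (v (γ t)) (Icc 0 T) t)
    (hδ : ∀ t ∈ Icc 0 T, HasDerivWithinAt δ (v (δ t)) (Icc 0 T) t) (h0 : γ 0 = δ 0) :
    EqOn γ δ (Icc 0 T) := by
  have cγ : ContinuousOn γ (Icc 0 T) := fun t ht => (hγ t ht).continuousWithinAt
  have cδ : ContinuousOn δ (Icc 0 T) := fun t ht => (hδ t ht).continuousWithinAt
  -- The field is only locally Lipschitz; a global constant exists on the compact union of the two
  -- trajectories.
  obtain ⟨K, hK⟩ := (hv.locallyLipschitz.locallyLipschitzOn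
    (s := γ '' Icc 0 T ∪ δ '' Icc 0 T)).exists_lipschitzOnWith_of_compact
      ((isCompact_Icc.image_of_continuousOn cγ).union (isCompact_Icc.image_of_continuousOn cδ))
  exact ODE_solution_unique_of_mem_Icc_right (v := fun _ => v) (fun _ _ => hK) cγ
    (fun t ht => (hγ t (Ico_subset_Icc_self ht)).mono_of_mem_nhdsWithin (Icc_mem_nhdsGE_of_mem ht))
    (fun t ht => Or.inl (mem_image_of_mem _ (Ico_subset_Icc_self ht))) cδ
    (fun t ht => (hδ t (Ico_subset_Icc_self ht)).mono_of_mem_nhdsWithin (Icc_mem_nhdsGE_of_mem ht))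
    (fun t ht => Or.inr (mem_image_of_mem _ (Ico_subset_Icc_self ht))) h0

theorem ode_unique {v : ℝ × ℝ → ℝ × ℝ} (hv : ContDiff ℝ 1 v) {γ δ : ℝ → ℝ × ℝ}
    (hγ : ∀ t, HasDerivAt γ (v (γ t)) t) (hδ : ∀ t, HasDerivAt δ (v (δ t)) t) (h0 : γ 0 = δ 0) :
    γ = δ := by
  ext1 t
  rcases le_total 0 t with ht | ht
  · exact ode_unique_Icc hv (fun s _ => (hγ s).hasDerivWithinAt)
      (fun s _ => (hδ s).hasDerivWithinAt) h0 (right_mem_Icc.2 ht)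
  · have key : ∀ γ : ℝ → ℝ × ℝ, (∀ t, HasDerivAt γ (v (γ t)) t) → ∀ s ∈ Icc 0 (-t),
        HasDerivWithinAt (fun s => γ (-s)) (-v (γ (-s))) (Icc 0 (-t)) s := fun γ h s _ => by
      have := ((h (-s)).scomp s (hasDerivAt_neg s)).hasDerivWithinAt (s := Icc 0 (-t))
      rw [neg_smul, one_smul] at this
      exact this
    have := ode_unique_Icc hv.neg (key γ hγ) (key δ hδ) (by simpa using h0)
      (right_mem_Icc.2 (neg_nonneg.2 ht))
    simpa using this

theorem contDiff_field (c : HamCase) (l : Fin 6 → ℝ) : ContDiff ℝ ω (c.field l) := by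
  unfold HamCase.field
  fun_prop

namespace IsSol

variable {c : HamCase} {T : ℝ} {z : ℝ × ℝ} {l : Fin 6 → ℝ} {g g' : PlanePath}

theorem hasDerivWithinAt (h : IsSol c T z l g) {t : ℝ} (ht : t ∈ Icc (0 : ℝ) 1) :
    HasDerivWithinAt (fun t => pathEval g (toUnit t)) (T • c.field l (pathEval g (toUnit t)))
      (Icc 0 1) t := by
  rw [field_pathEval]
  have h1 := h.deriv_fst ⟨t, ht⟩
  have h2 := h.deriv_snd ⟨t, ht⟩
  rw [show toUnit t = ⟨t, ht⟩ from projIcc_of_mem _ ht]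
  exact h1.prodMk h2

/-- Used to identify the paths produced by separate applications of the implicit function theorem.
-/
theorem unique (h : IsSol c T z l g) (h' : IsSol c T z l g') : g = g' := by
  have key := ode_unique_Icc (v := fun z => T • c.field l z) (T := 1)
    (((contDiff_field c l).of_le (by simp)).const_smul T)
    (fun t ht => h.hasDerivWithinAt ht) (fun t ht => h'.hasDerivWithinAt ht) (by
      have : toUnit 0 = 0 := projIcc_left _
      rw [this, h.start, h'.start])
  have : ∀ s : unitInterval, pathEval g s = pathEval g' s := fun s => by
    simpa [toUnit_coe] using key s.2
  exact Prod.ext (ContinuousMap.ext fun s => congrArg Prod.fst (this s))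
    (ContinuousMap.ext fun s => congrArg Prod.snd (this s))

/-- The solution in the original time. -/
theorem hasDerivWithinAt_div (h : IsSol c T z l g) (hT : 0 < T) {t : ℝ} (ht : t ∈ Icc (0 : ℝ) T) :
    HasDerivWithinAt (fun t => pathEval g (toUnit (t / T)))
      (c.field l (pathEval g (toUnit (t / T)))) (Icc 0 T) t := by
  have ht' : t / T ∈ Icc (0 : ℝ) 1 := ⟨div_nonneg ht.1 hT.le, (div_le_one hT).2 ht.2⟩
  have hd : HasDerivWithinAt (fun t : ℝ => t / T) T⁻¹ (Icc 0 T) t := by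
    simpa using ((hasDerivAt_id t).div_const T).hasDerivWithinAt
  have := (h.hasDerivWithinAt ht').scomp t hd
    (t' := Icc 0 1) (fun s hs => ⟨div_nonneg hs.1 hT.le, (div_le_one hT).2 hs.2⟩)
  rw [smul_smul, inv_mul_cancel₀ hT.ne', one_smul] at this
  exact this

/-- Restriction of a solution to an initial time segment. -/
theorem restrict (h : IsSol c T z l g) (r : unitInterval) :
    ∃ g' : PlanePath, IsSol c (T * r) z l g' ∧ pathEval g' 1 = pathEval g r := by
  let m : C(unitInterval, unitInterval) := ⟨fun s => r * s, by fun_prop⟩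
  have hd : ∀ u u' : C(unitInterval, ℝ), PathDeriv u u' →
      PathDeriv (u.comp m) ((r : ℝ) • u'.comp m) := by
    intro u u' hu s
    have h1 : HasDerivWithinAt (fun t : ℝ => (r : ℝ) * t) r (Icc 0 1) s := by
      simpa using ((hasDerivAt_id (s : ℝ)).const_mul (r : ℝ)).hasDerivWithinAt
    have h2 : HasDerivWithinAt (fun t => u (toUnit t)) (u' (m s)) (Icc 0 1) ((r : ℝ) * s) :=
      hu (r * s)
    have := h2.scomp (s : ℝ) h1 (fun t ht => (r * ⟨t, ht⟩ : unitInterval).2)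
    refine this.congr_of_mem (fun t ht => ?_) s.2
    have e1 : toUnit t = ⟨t, ht⟩ := projIcc_of_mem _ ht
    have e2 : toUnit ((r : ℝ) * t) = r * ⟨t, ht⟩ := projIcc_of_mem _ (r * ⟨t, ht⟩ : unitInterval).2
    simp only [ContinuousMap.comp_apply, Function.comp_apply]
    rw [e1, e2]
    rfl
  refine ⟨(g.1.comp m, g.2.comp m), ⟨?_, ?_, ?_⟩, ?_⟩
  · rw [← h.start]
    simp [pathEval, m]
  · refine (hd _ _ h.deriv_fst).congr_right ?_
    ext s
    simp
    ring
  · refine (hd _ _ h.deriv_snd).congr_right ?_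
    ext s
    simp [fieldPath]
    ring
  · simp [pathEval, m]

end IsSol

/-- The path `s ↦ γ (T s)`. -/
def samplePath (γ : ℝ → ℝ × ℝ) (hγ : Continuous γ) (T : ℝ) : PlanePath :=
  (⟨fun s => (γ (T * s)).1, by fun_prop⟩, ⟨fun s => (γ (T * s)).2, by fun_prop⟩)

theorem pathEval_samplePath (γ : ℝ → ℝ × ℝ) (hγ : Continuous γ) (T : ℝ) (s : unitInterval) :
    pathEval (samplePath γ hγ T) s = γ (T * s) := rfl

theorem isSol_samplePath {c : HamCase} {l : Fin 6 → ℝ} {γ : ℝ → ℝ × ℝ} (hγ : Continuous γ)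
    (hd : ∀ t, HasDerivAt γ (c.field l (γ t)) t) (T : ℝ) :
    IsSol c T (γ 0) l (samplePath γ hγ T) := by
  have key : ∀ s : unitInterval, HasDerivWithinAt (fun t => γ (T * toUnit t))
      (T • c.field l (γ (T * s))) (Icc 0 1) s := by
    intro s
    have h1 : HasDerivAt (fun t : ℝ => T * t) T s := by
      simpa using (hasDerivAt_id (s : ℝ)).const_mul T
    refine ((hd (T * s)).scomp (s : ℝ) h1).hasDerivWithinAt.congr_of_mem (fun t ht => ?_) s.2
    rw [show toUnit t = ⟨t, ht⟩ from projIcc_of_mem _ ht]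
    rfl
  refine ⟨by simp [pathEval_samplePath], fun s => ?_, fun s => ?_⟩
  · have := (key s).fst
    rw [← pathEval_samplePath γ hγ, field_pathEval] at this
    exact this
  · have := (key s).snd
    rw [← pathEval_samplePath γ hγ, field_pathEval] at this
    exact this

/-! ### Levels, conservation of energy, equilibria -/

namespace PeriodAnnulus

theorem isOpen_levels (A : PeriodAnnulus) : IsOpen A.levels := by
  cases A <;> simp only [levels] <;> first | exact isOpen_Ioi | exact isOpen_Ioo

theorem levels_nonempty (A : PeriodAnnulus) : A.levels.Nonempty := by
  cases A <;> simp only [levels]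
  · exact ⟨1, by norm_num⟩
  · exact ⟨1 / 8, by norm_num, by norm_num⟩
  · exact ⟨-1 / 8, by norm_num, by norm_num⟩
  · exact ⟨-1 / 8, by norm_num, by norm_num⟩
  · exact ⟨1, by norm_num⟩

end PeriodAnnulus

theorem hasFDerivAt_ham (c : HamCase) (z : ℝ × ℝ) :
    HasFDerivAt c.ham ((c.a * z.1 + c.b * z.1 ^ 3) • ContinuousLinearMap.fst ℝ ℝ ℝ +
      z.2 • ContinuousLinearMap.snd ℝ ℝ ℝ) z := by
  have h1 : HasFDerivAt (fun z : ℝ × ℝ => z.1) (ContinuousLinearMap.fst ℝ ℝ ℝ) z := hasFDerivAt_fst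
  have h2 : HasFDerivAt (fun z : ℝ × ℝ => z.2) (ContinuousLinearMap.snd ℝ ℝ ℝ) z := hasFDerivAt_snd
  have h := (((h2.pow 2).const_smul (1 / 2 : ℝ)).add ((h1.pow 2).const_smul (c.a / 2))).add
    ((h1.pow 4).const_smul (c.b / 4))
  refine (h.congr_of_eventuallyEq (Eventually.of_forall fun w => ?_)).congr_fderiv ?_
  · simp [HamCase.ham]
    ring
  · refine ContinuousLinearMap.ext fun u => ?_
    simp
    ring

theorem continuous_ham (c : HamCase) : Continuous c.ham := by
  unfold HamCase.ham
  fun_prop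

theorem ham_eq_of_solution {c : HamCase} {γ : ℝ → ℝ × ℝ}
    (hγ : ∀ t, HasDerivAt γ (c.field 0 (γ t)) t) (s t : ℝ) : c.ham (γ s) = c.ham (γ t) := by
  have h : ∀ t, HasDerivAt (fun t => c.ham (γ t)) 0 t := fun t => by
    refine ((hasFDerivAt_ham c (γ t)).comp_hasDerivAt t (hγ t)).congr_deriv ?_
    simp [HamCase.field]
    ring
  exact is_const_of_deriv_eq_zero (fun t => (h t).differentiableAt) (fun t => (h t).deriv) s t

/-- Equilibria have y = 0 and either x = 0, at level 0, or x² = 1, at level 1/4 or -1/4 according to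
the case. None of them has an admissible level and lies in the strip. -/
theorem field_ne_zero_of_mem_oval {A : PeriodAnnulus} {h : ℝ} (hh : h ∈ A.levels) {z : ℝ × ℝ}
    (hz : z ∈ A.oval h) : A.hamCase.field 0 z ≠ 0 := by
  obtain ⟨x, y⟩ := z
  obtain ⟨hs, hH⟩ := hz
  intro h0
  simp only [HamCase.field, Prod.mk_eq_zero, Pi.zero_apply] at h0
  obtain ⟨rfl, h1⟩ := h0
  have h2 : x * (A.hamCase.a + A.hamCase.b * x ^ 2) = 0 := by linarith
  simp only [HamCase.ham] at hH
  cases A <;> simp only [PeriodAnnulus.hamCase, HamCase.a, HamCase.b, PeriodAnnulus.levels,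
    PeriodAnnulus.strip, mem_Ioi, mem_Ioo, mem_Iio] at * <;>
    rcases mul_eq_zero.1 h2 with h3 | h3
  all_goals first
    | (subst h3; norm_num at hH; linarith)
    | nlinarith

/-! ### The first return map near an unperturbed orbit -/

section Section

variable {A : PeriodAnnulus} {σ : ℝ → ℝ × ℝ}

theorem PeriodAnnulus.IsCrossSection.ham_eq (hσ : A.IsCrossSection σ) {h : ℝ} (hh : h ∈ A.levels) :
    A.hamCase.ham (σ h) = h := (hσ.2 h hh).2

/-- Replaces membership in the section by the equation z = σ (H z), which behaves well under limits.
-/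
theorem PeriodAnnulus.IsCrossSection.eq_of_mem (hσ : A.IsCrossSection σ) {z : ℝ × ℝ}
    (hz : z ∈ σ '' A.levels) : A.hamCase.ham z ∈ A.levels ∧ z = σ (A.hamCase.ham z) := by
  obtain ⟨k, hk, rfl⟩ := hz
  rw [hσ.ham_eq hk]
  exact ⟨hk, rfl⟩

/-- Near an orbit joining the section to itself on the level `h₀`, the hitting time and the level
of the hitting point are analytic functions of the initial level and of the parameters. -/
theorem exists_local_return (hσ : A.IsCrossSection σ) {h₀ : ℝ} (hh : h₀ ∈ A.levels)
    {γ : ℝ → ℝ × ℝ} (hc : Continuous γ) (hγ : ∀ t, HasDerivAt γ (A.hamCase.field 0 (γ t)) t)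
    (h0 : γ 0 = σ h₀) {T : ℝ} (hT : γ T = σ h₀) :
    ∃ (Γ : ℝ × (ℝ × (Fin 6 → ℝ)) → PlanePath) (ψ : ℝ × (Fin 6 → ℝ) → ℝ × ℝ),
      AnalyticAt ℝ Γ (T, (h₀, 0)) ∧ Γ (T, (h₀, 0)) = samplePath γ hc T ∧
      (∀ᶠ q in 𝓝 (T, (h₀, (0 : Fin 6 → ℝ))), IsSol A.hamCase q.1 (σ q.2.1) q.2.2 (Γ q)) ∧
      AnalyticAt ℝ ψ (h₀, 0) ∧ ψ (h₀, 0) = (T, h₀) ∧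
      ∀ᶠ v in 𝓝 ((h₀, (0 : Fin 6 → ℝ)), (T, h₀)),
        pathEval (Γ (v.2.1, v.1)) 1 = σ v.2.2 ↔ ψ v.1 = v.2 := by
  have hsol : IsSol A.hamCase T (σ h₀) 0 (samplePath γ hc T) := h0 ▸ isSol_samplePath hc hγ T
  obtain ⟨Φ, hΦ, hΦ0, hΦs⟩ := exists_flow hsol
  have hσa : AnalyticAt ℝ σ h₀ := hσ.1 h₀ hh
  set m : ℝ × (ℝ × (Fin 6 → ℝ)) → ℝ × ((ℝ × ℝ) × (Fin 6 → ℝ)) :=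
    fun q => (q.1, (σ q.2.1, q.2.2)) with hm
  have hma : AnalyticAt ℝ m (T, (h₀, 0)) := by
    have : AnalyticAt ℝ (fun q : ℝ × (ℝ × (Fin 6 → ℝ)) => σ q.2.1) (T, (h₀, 0)) :=
      AnalyticAt.fun_comp (g := σ) (f := fun q : ℝ × (ℝ × (Fin 6 → ℝ)) => q.2.1) hσa
        (analyticAt_fst.comp analyticAt_snd)
    exact analyticAt_fst.prod (this.prod (analyticAt_snd.comp analyticAt_snd))
  set Γ : ℝ × (ℝ × (Fin 6 → ℝ)) → PlanePath := fun q => Φ (m q) with hΓ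
  have hΓa : AnalyticAt ℝ Γ (T, (h₀, 0)) := AnalyticAt.fun_comp (g := Φ) (f := m) hΦ hma
  have hΓs : ∀ᶠ q in 𝓝 (T, (h₀, (0 : Fin 6 → ℝ))),
      IsSol A.hamCase q.1 (σ q.2.1) q.2.2 (Γ q) := hma.continuousAt.eventually hΦs
  -- Zeros of `G` are hits of the section; the unknowns are the hitting time and the level hit.
  set G : (ℝ × (Fin 6 → ℝ)) × (ℝ × ℝ) → ℝ × ℝ :=
    fun v => pathEval (Γ (v.2.1, v.1)) 1 - σ v.2.2 with hG
  set u : (ℝ × (Fin 6 → ℝ)) × (ℝ × ℝ) := ((h₀, 0), (T, h₀)) with hu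
  have hGa : AnalyticAt ℝ G u := by
    have h1 : AnalyticAt ℝ (fun v : (ℝ × (Fin 6 → ℝ)) × (ℝ × ℝ) => Γ (v.2.1, v.1)) u :=
      AnalyticAt.fun_comp (g := Γ) (f := fun v : (ℝ × (Fin 6 → ℝ)) × (ℝ × ℝ) => (v.2.1, v.1)) hΓa
        ((analyticAt_fst.comp analyticAt_snd).prod analyticAt_fst)
    have h2 : AnalyticAt ℝ (fun v : (ℝ × (Fin 6 → ℝ)) × (ℝ × ℝ) => σ v.2.2) u :=
      AnalyticAt.fun_comp (g := σ) (f := fun v : (ℝ × (Fin 6 → ℝ)) × (ℝ × ℝ) => v.2.2) hσa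
        (analyticAt_snd.comp analyticAt_snd)
    have h3 : AnalyticAt ℝ (fun v : (ℝ × (Fin 6 → ℝ)) × (ℝ × ℝ) =>
        ((Γ (v.2.1, v.1)).1 1, (Γ (v.2.1, v.1)).2 1)) u :=
      (((ContinuousMap.evalCLM ℝ (1 : unitInterval)).analyticAt _).fun_comp
        (analyticAt_fst.fun_comp h1)).prod
        (((ContinuousMap.evalCLM ℝ (1 : unitInterval)).analyticAt _).fun_comp
          (analyticAt_snd.fun_comp h1))
    exact h3.sub h2
  have hGu : G u = 0 := by
    have : Γ (T, (h₀, 0)) = samplePath γ hc T := hΦ0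
    simp only [hG, hu]
    rw [this, pathEval_samplePath]
    simp [hT]
  have hcd : ContDiffAt ℝ ω G u := hGa.contDiffAt
  have hinv : (fderiv ℝ G u ∘L .inr ℝ _ _).IsInvertible := by
    have h1 : HasFDerivAt (fun w => G ((h₀, 0), w)) (fderiv ℝ G u ∘L .inr ℝ _ _) (T, h₀) :=
      (hcd.differentiableAt (by simp)).hasFDerivAt.comp (T, h₀) (hasFDerivAt_prodMk_right _ _)
    have h2 : HasFDerivAt (fun w : ℝ × ℝ => γ w.1 - σ w.2)
        ((ContinuousLinearMap.toSpanSingleton ℝ (A.hamCase.field 0 (σ h₀))) ∘L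
            ContinuousLinearMap.fst ℝ ℝ ℝ -
          (ContinuousLinearMap.toSpanSingleton ℝ (deriv σ h₀)) ∘L
            ContinuousLinearMap.snd ℝ ℝ ℝ) (T, h₀) := by
      have e1 := (hγ T).hasFDerivAt
      rw [hT] at e1
      exact (e1.comp (T, h₀) hasFDerivAt_fst).sub
        (hσa.differentiableAt.hasDerivAt.hasFDerivAt.comp (T, h₀) hasFDerivAt_snd)
    -- With the initial level and the parameters frozen, `Γ` samples the unperturbed orbit, so the
    -- partial derivative is explicit.
    have h3 : (fun w => G ((h₀, 0), w)) =ᶠ[𝓝 (T, h₀)] fun w : ℝ × ℝ => γ w.1 - σ w.2 := by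
      have ht : Tendsto (fun w : ℝ × ℝ => (w.1, (h₀, (0 : Fin 6 → ℝ)))) (𝓝 (T, h₀))
          (𝓝 (T, (h₀, 0))) := by
        have : Continuous (fun w : ℝ × ℝ => (w.1, (h₀, (0 : Fin 6 → ℝ)))) := by fun_prop
        exact this.tendsto _
      filter_upwards [ht.eventually hΓs] with w hw
      have := hw.unique (h0 ▸ isSol_samplePath hc hγ w.1)
      simp only [hG]
      rw [this, pathEval_samplePath]
      simp
    rw [h1.unique (h2.congr_of_eventuallyEq h3)]
    have hdσ : HasDerivAt (fun h => A.hamCase.ham (σ h)) _ h₀ :=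
      (hasFDerivAt_ham A.hamCase (σ h₀)).comp_hasDerivAt h₀ hσa.differentiableAt.hasDerivAt
    -- Transversality: dH takes the value 1 on σ' and 0 on `X_0`.
    have hid : HasDerivAt (fun h => A.hamCase.ham (σ h)) 1 h₀ := by
      refine (hasDerivAt_id h₀).congr_of_eventuallyEq ?_
      filter_upwards [A.isOpen_levels.mem_nhds hh] with h hh'
      exact hσ.ham_eq hh'
    have hd1 := hdσ.unique hid
    simp only [add_apply, smul_apply,
      ContinuousLinearMap.coe_fst', ContinuousLinearMap.coe_snd', smul_eq_mul] at hd1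
    have hf0 := field_ne_zero_of_mem_oval hh (hσ.2 h₀ hh)
    set D := (ContinuousLinearMap.toSpanSingleton ℝ (A.hamCase.field 0 (σ h₀))) ∘L
            ContinuousLinearMap.fst ℝ ℝ ℝ -
          (ContinuousLinearMap.toSpanSingleton ℝ (deriv σ h₀)) ∘L
            ContinuousLinearMap.snd ℝ ℝ ℝ with hD
    have hinj : Function.Injective D := by
      rw [injective_iff_map_eq_zero]
      rintro ⟨r, k⟩ h
      simp only [hD, sub_apply, ContinuousLinearMap.comp_apply,
        ContinuousLinearMap.coe_fst', ContinuousLinearMap.coe_snd',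
        ContinuousLinearMap.toSpanSingleton_apply] at h
      have e1 := congrArg Prod.fst h
      have e2 := congrArg Prod.snd h
      simp only [HamCase.field, Prod.fst_sub, Prod.snd_sub, Prod.smul_fst, Prod.smul_snd,
        smul_eq_mul, Prod.fst_zero, Prod.snd_zero, Pi.zero_apply] at e1 e2
      -- Pairing r X_0 = k σ' with dH leaves k = 0; then r = 0 because the field does not vanish.
      have hk : k = 0 := by
        linear_combination (-(A.hamCase.a * (σ h₀).1 + A.hamCase.b * (σ h₀).1 ^ 3)) * e1 -
          (σ h₀).2 * e2 - k * hd1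
      subst hk
      simp only [zero_smul, sub_zero] at h
      rw [(smul_eq_zero.1 h).resolve_right hf0]
      rfl
    have hbij : Function.Surjective D :=
      (LinearMap.injective_iff_surjective (f := (D : ℝ × ℝ →ₗ[ℝ] ℝ × ℝ))).1 hinj
    exact ⟨ContinuousLinearEquiv.ofBijective D (LinearMap.ker_eq_bot.2 hinj)
      (LinearMap.range_eq_top.2 hbij), ContinuousLinearEquiv.coe_ofBijective _ _ _⟩
  refine ⟨Γ, hcd.implicitFunction (by simp) hinv, hΓa, hΦ0, hΓs, ?_,
    hcd.implicitFunction_apply_self _ _, ?_⟩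
  · exact (hcd.contDiffAt_implicitFunction (by simp) hinv).analyticAt
  · filter_upwards [hcd.eventually_apply_eq_iff_implicitFunction (by simp) hinv] with v hv
    rw [← hv, hGu, hG, sub_eq_zero]

/-- Serves to recognize the branch of hits passing through time 0 as the trivial one. -/
theorem IsSol.eq_of_time_zero {c : HamCase} {z : ℝ × ℝ} {l : Fin 6 → ℝ} {g : PlanePath}
    (h : IsSol c 0 z l g) (s : unitInterval) : pathEval g s = z := by
  have h1 := congrArg (fun f : C(unitInterval, ℝ) => f s) h.deriv_fst.eq_primitive
  have h2 := congrArg (fun f : C(unitInterval, ℝ) => f s) h.deriv_snd.eq_primitive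
  simp only [zero_smul, map_zero, add_zero, ContinuousMap.smul_apply, ContinuousMap.one_apply,
    smul_eq_mul, mul_one] at h1 h2
  rw [← h.start]
  exact Prod.ext h1 h2

theorem continuousAt_pathEval {P : Type*} [TopologicalSpace P] {Γ : P → PlanePath} {p : P}
    (hΓ : ContinuousAt Γ p) (s : unitInterval) :
    ContinuousAt (fun v : P × unitInterval => pathEval (Γ v.1) v.2) (p, s) := by
  have h1 : ContinuousAt (fun v : P × unitInterval => Γ v.1) (p, s) :=
    ContinuousAt.comp (f := Prod.fst) (g := Γ) hΓ continuousAt_fst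
  have ev : Continuous fun w : C(unitInterval, ℝ) × unitInterval => w.1 w.2 := by fun_prop
  exact (ev.continuousAt.comp ((continuousAt_fst.comp h1).prodMk continuousAt_snd)).prodMk
    (ev.continuousAt.comp ((continuousAt_snd.comp h1).prodMk continuousAt_snd))

/-- First return to the section: existence for all levels and parameters close to those of an
unperturbed periodic orbit, with analytic return time, return level and trajectory. -/
theorem exists_first_return (hσ : A.IsCrossSection σ) {h₀ : ℝ} (hh : h₀ ∈ A.levels)
    {γ : ℝ → ℝ × ℝ} (hc : Continuous γ) (hγ : ∀ t, HasDerivAt γ (A.hamCase.field 0 (γ t)) t)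
    (h0 : γ 0 = σ h₀) {T : ℝ} (hT0 : 0 < T) (hT : γ T = σ h₀)
    (hfirst : ∀ t ∈ Ioo 0 T, γ t ∉ σ '' A.levels) :
    ∃ (τ κ : ℝ × (Fin 6 → ℝ) → ℝ) (Γ : ℝ × (Fin 6 → ℝ) → PlanePath),
      AnalyticAt ℝ τ (h₀, 0) ∧ AnalyticAt ℝ κ (h₀, 0) ∧ AnalyticAt ℝ Γ (h₀, 0) ∧
      τ (h₀, 0) = T ∧ κ (h₀, 0) = h₀ ∧ Γ (h₀, 0) = samplePath γ hc T ∧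
      ∀ᶠ p in 𝓝 (h₀, (0 : Fin 6 → ℝ)),
        p.1 ∈ A.levels ∧ κ p ∈ A.levels ∧ 0 < τ p ∧
        IsSol A.hamCase (τ p) (σ p.1) p.2 (Γ p) ∧ pathEval (Γ p) 1 = σ (κ p) ∧
        ∀ s : unitInterval, 0 < s → s < 1 → pathEval (Γ p) s ∉ σ '' A.levels := by
  -- Two branches of hits are used: `ψ₁` through time T gives the return, and `ψ₀` through time 0
  -- rules out early returns.
  obtain ⟨Γ₁, ψ₁, hΓ₁, hΓ₁e, hΓ₁s, hψ₁, hψ₁e, hi₁⟩ := exists_local_return hσ hh hc hγ h0 hT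
  obtain ⟨Γ₀, ψ₀, hΓ₀, hΓ₀e, hΓ₀s, hψ₀, hψ₀e, hi₀⟩ := exists_local_return hσ hh hc hγ h0 h0
  set p₀ : ℝ × (Fin 6 → ℝ) := (h₀, 0) with hp₀
  set τ : ℝ × (Fin 6 → ℝ) → ℝ := fun p => (ψ₁ p).1
  set κ : ℝ × (Fin 6 → ℝ) → ℝ := fun p => (ψ₁ p).2
  have hτ : AnalyticAt ℝ τ p₀ := analyticAt_fst.comp hψ₁
  have hκ : AnalyticAt ℝ κ p₀ := analyticAt_snd.comp hψ₁
  have hτe : τ p₀ = T := congrArg Prod.fst hψ₁e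
  have hκe : κ p₀ = h₀ := congrArg Prod.snd hψ₁e
  set Γ : ℝ × (Fin 6 → ℝ) → PlanePath := fun p => Γ₁ (τ p, p) with hΓdef
  have hpair : AnalyticAt ℝ (fun p => (τ p, p)) p₀ := hτ.prod analyticAt_id
  have hΓ : AnalyticAt ℝ Γ p₀ :=
    AnalyticAt.fun_comp (g := Γ₁) (f := fun p => (τ p, p)) (by rw [hτe]; exact hΓ₁) hpair
  have hΓe : Γ p₀ = samplePath γ hc T := by rw [hΓdef]; simp only; rw [hτe]; exact hΓ₁e
  have hsol : ∀ᶠ p in 𝓝 p₀, IsSol A.hamCase (τ p) (σ p.1) p.2 (Γ p) := by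
    have := hpair.continuousAt.tendsto
    rw [hτe] at this
    exact this.eventually hΓ₁s
  have hlev : ∀ᶠ p in 𝓝 p₀, p.1 ∈ A.levels :=
    continuousAt_fst.eventually (A.isOpen_levels.mem_nhds hh)
  have hret : ∀ᶠ p in 𝓝 p₀, pathEval (Γ p) 1 = σ (κ p) := by
    have ht : Tendsto (fun p => (p, ψ₁ p)) (𝓝 p₀) (𝓝 (p₀, (T, h₀))) := by
      have := (continuousAt_id (x := p₀)).prodMk hψ₁.continuousAt
      rw [← hψ₁e]
      exact this
    filter_upwards [ht.eventually hi₁] with p hp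
    exact hp.2 rfl
  -- a hit on the section at time `τ s` close to the time `T'`
  have hit : ∀ (Γ' : ℝ × (ℝ × (Fin 6 → ℝ)) → PlanePath) (ψ' : ℝ × (Fin 6 → ℝ) → ℝ × ℝ)
      (s₀ : unitInterval), γ (T * s₀) = σ h₀ →
      (∀ᶠ q in 𝓝 (T * s₀, p₀), IsSol A.hamCase q.1 (σ q.2.1) q.2.2 (Γ' q)) →
      (∀ᶠ v in 𝓝 (p₀, (T * s₀, h₀)),
        pathEval (Γ' (v.2.1, v.1)) 1 = σ v.2.2 ↔ ψ' v.1 = v.2) →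
      ∀ᶠ w in 𝓝 (p₀, s₀), pathEval (Γ w.1) w.2 ∈ σ '' A.levels →
        (ψ' w.1).1 = τ w.1 * w.2 := by
    intro Γ' ψ' s₀ hs₀ hΓ' hψ'
    have hev := continuousAt_pathEval hΓ.continuousAt s₀
    have hτc : ContinuousAt (fun w : (ℝ × (Fin 6 → ℝ)) × unitInterval => τ w.1 * (w.2 : ℝ)) (p₀, s₀) := by
      have : ContinuousAt (fun w : (ℝ × (Fin 6 → ℝ)) × unitInterval => τ w.1) (p₀, s₀) :=
        ContinuousAt.comp (f := Prod.fst) (g := τ) hτ.continuousAt continuousAt_fst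
      exact this.mul (continuous_subtype_val.continuousAt.comp continuousAt_snd)
    have h1 : Tendsto (fun w : (ℝ × (Fin 6 → ℝ)) × unitInterval => (τ w.1 * (w.2 : ℝ), w.1)) (𝓝 (p₀, s₀))
        (𝓝 (T * s₀, p₀)) := by
      have := (hτc.prodMk continuousAt_fst).tendsto
      rw [hτe] at this
      exact this
    have h2 : Tendsto (fun w : (ℝ × (Fin 6 → ℝ)) × unitInterval =>
        (w.1, (τ w.1 * (w.2 : ℝ), A.hamCase.ham (pathEval (Γ w.1) w.2)))) (𝓝 (p₀, s₀))
        (𝓝 (p₀, (T * s₀, h₀))) := by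
      have := (continuousAt_fst.prodMk
        (hτc.prodMk ((continuous_ham A.hamCase).continuousAt.comp hev))).tendsto
      simp only [Function.comp_apply] at this
      rw [hτe, hΓe, pathEval_samplePath, hs₀, hσ.ham_eq hh] at this
      exact this
    filter_upwards [h1.eventually hΓ', h2.eventually hψ', continuousAt_fst.eventually hsol]
      with w hw1 hw2 hw3 hmem
    -- Cut the orbit at the hit and rescale it to [0,1]; uniqueness identifies it with the path
    -- attached to the local branch.
    obtain ⟨g', hg', hg'e⟩ := hw3.restrict w.2
    have e : Γ' (τ w.1 * w.2, w.1) = g' := hw1.unique hg'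
    rw [e, hg'e] at hw2
    have := hw2.1 (hσ.eq_of_mem hmem).2
    rw [this]
  have hψ₀z : ∀ᶠ p in 𝓝 p₀, (ψ₀ p).1 = 0 := by
    have h1 : Tendsto (fun p : ℝ × (Fin 6 → ℝ) => ((0 : ℝ), p)) (𝓝 p₀) (𝓝 (0, p₀)) := by
      have : Continuous fun p : ℝ × (Fin 6 → ℝ) => ((0 : ℝ), p) := by fun_prop
      exact this.tendsto _
    have h2 : Tendsto (fun p : ℝ × (Fin 6 → ℝ) => (p, ((0 : ℝ), p.1))) (𝓝 p₀)
        (𝓝 (p₀, (0, h₀))) := by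
      have : Continuous fun p : ℝ × (Fin 6 → ℝ) => (p, ((0 : ℝ), p.1)) := by fun_prop
      exact this.tendsto _
    filter_upwards [h1.eventually hΓ₀s, h2.eventually hi₀] with p hp1 hp2
    have := hp2.1 (hp1.eq_of_time_zero 1)
    rw [this]
  have hpos : ∀ᶠ p in 𝓝 p₀, 0 < τ p :=
    hτ.continuousAt.eventually (lt_mem_nhds (by rw [hτe]; exact hT0))
  have hκl : ∀ᶠ p in 𝓝 p₀, κ p ∈ A.levels :=
    hκ.continuousAt.eventually (A.isOpen_levels.mem_nhds (by rw [hκe]; exact hh))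
  have havoid : ∀ᶠ p in 𝓝 p₀, ∀ s ∈ (univ : Set unitInterval), 0 < s → s < 1 →
      pathEval (Γ p) s ∉ σ '' A.levels := by
    -- By compactness it is enough to avoid the section near each rescaled time s₀. Near 0 and 1 a
    -- hit would have to be the start or the return itself; elsewhere the unperturbed orbit is off
    -- the section, an open condition.
    refine isCompact_univ.eventually_forall_of_forall_eventually fun s₀ _ => ?_
    by_cases hs0 : s₀ = 0
    · subst hs0
      have := hit Γ₀ ψ₀ 0 (by simpa using h0) (by simpa using hΓ₀s) (by simpa using hi₀)
      filter_upwards [this, continuousAt_fst.eventually hψ₀z, continuousAt_fst.eventually hpos]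
        with w hw hz hp hs _ hmem
      have e := hw hmem
      rw [hz] at e
      have : (0 : ℝ) < w.2 := hs
      have := mul_pos hp this
      linarith
    by_cases hs1 : s₀ = 1
    · subst hs1
      have := hit Γ₁ ψ₁ 1 (by simpa using hT) (by simpa using hΓ₁s) (by simpa using hi₁)
      filter_upwards [this, continuousAt_fst.eventually hpos] with w hw hp _ hs hmem
      have e := hw hmem
      have h1 : (w.2 : ℝ) < 1 := hs
      have := mul_lt_mul_of_pos_left h1 hp
      simp only [τ] at this hp e
      linarith
    · have hpos0 : (0 : ℝ) < s₀ := lt_of_le_of_ne s₀.2.1 fun h => hs0 (Subtype.ext h.symm)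
      have hlt1 : (s₀ : ℝ) < 1 := lt_of_le_of_ne s₀.2.2 fun h => hs1 (Subtype.ext h)
      have hn := hfirst (T * s₀) ⟨mul_pos hT0 hpos0, by nlinarith⟩
      have hH : A.hamCase.ham (γ (T * s₀)) = h₀ := by
        rw [ham_eq_of_solution hγ _ 0, h0, hσ.ham_eq hh]
      have hne : γ (T * s₀) ≠ σ (A.hamCase.ham (γ (T * s₀))) := by
        intro h
        rw [hH] at h
        exact hn ⟨h₀, hh, h.symm⟩
      have hcσ : ContinuousAt (fun z => σ (A.hamCase.ham z)) (γ (T * s₀)) := by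
        refine ContinuousAt.comp (g := σ) ?_ (continuous_ham A.hamCase).continuousAt
        rw [hH]
        exact (hσ.1 h₀ hh).continuousAt
      have hev := continuousAt_pathEval hΓ.continuousAt s₀
      have ht : Tendsto (fun w : (ℝ × (Fin 6 → ℝ)) × unitInterval => pathEval (Γ w.1) w.2) (𝓝 (p₀, s₀))
          (𝓝 (γ (T * s₀))) := by
        have := hev.tendsto
        simp only at this
        rw [hΓe, pathEval_samplePath] at this
        exact this
      filter_upwards [ht.eventually ((tendsto_id.prodMk_nhds hcσ.tendsto).eventually
        (isOpen_ne_fun continuous_fst continuous_snd |>.mem_nhds hne))] with w hw _ _ hmem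
      exact hw (hσ.eq_of_mem hmem).2
  refine ⟨τ, κ, Γ, hτ, hκ, hΓ, hτe, hκe, hΓe, ?_⟩
  filter_upwards [hlev, hκl, hpos, hsol, hret, havoid] with p h1 h2 h3 h4 h5 h6
  exact ⟨h1, h2, h3, h4, h5, fun s => h6 s (mem_univ s)⟩

/-- If one return came earlier, uniqueness of solutions would make it an interior hit of the other
orbit. -/
theorem first_return_unique {c : HamCase} {l : Fin 6 → ℝ} {S : Set (ℝ × ℝ)} {T T' : ℝ}
    {γ γ' : ℝ → ℝ × ℝ} (hT : 0 < T) (hT' : 0 < T')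
    (hγ : ∀ t ∈ Icc 0 T, HasDerivWithinAt γ (c.field l (γ t)) (Icc 0 T) t)
    (hγ' : ∀ t ∈ Icc 0 T', HasDerivWithinAt γ' (c.field l (γ' t)) (Icc 0 T') t)
    (h0 : γ 0 = γ' 0) (hS : γ T ∈ S) (hS' : γ' T' ∈ S) (hn : ∀ t ∈ Ioo 0 T, γ t ∉ S)
    (hn' : ∀ t ∈ Ioo 0 T', γ' t ∉ S) : T = T' ∧ EqOn γ γ' (Icc 0 T) := by
  have hv : ContDiff ℝ 1 (c.field l) := (contDiff_field c l).of_le (by simp)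
  have key : ∀ r, r ≤ T → r ≤ T' → EqOn γ γ' (Icc 0 r) := fun r h1 h2 =>
    ode_unique_Icc hv
      (fun t ht => (hγ t ⟨ht.1, ht.2.trans h1⟩).mono (Icc_subset_Icc_right h1))
      (fun t ht => (hγ' t ⟨ht.1, ht.2.trans h2⟩).mono (Icc_subset_Icc_right h2)) h0
  have e : T = T' := by
    rcases lt_trichotomy T T' with h | h | h
    · refine absurd ?_ (hn' T ⟨hT, h⟩)
      rw [← key T le_rfl h.le (right_mem_Icc.2 hT.le)]
      exact hS
    · exact h
    · refine absurd ?_ (hn T' ⟨hT', h⟩)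
      rw [key T' h.le le_rfl (right_mem_Icc.2 hT'.le)]
      exact hS'
  exact ⟨e, key T le_rfl e.le⟩

/-- A solution on the unit interval that avoids the section at interior times realizes the first
return. -/
theorem IsSol.isFirstReturn {c : HamCase} {T : ℝ} {z q : ℝ × ℝ} {l : Fin 6 → ℝ}
    {g : PlanePath} {S : Set (ℝ × ℝ)} (h : IsSol c T z l g) (hT : 0 < T)
    (h1 : pathEval g 1 = q) (hq : q ∈ S)
    (hn : ∀ s : unitInterval, 0 < s → s < 1 → pathEval g s ∉ S) : IsFirstReturn c l S z q := by
  refine ⟨T, hT, fun t => pathEval g (toUnit (t / T)),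
    fun t ht => h.hasDerivWithinAt_div hT ht, ?_, ?_, hq, fun t ht => ?_⟩
  · simp only [zero_div]
    rw [show toUnit 0 = 0 from projIcc_left _, h.start]
  · simp only [div_self hT.ne']
    rw [show toUnit 1 = 1 from projIcc_right _, h1]
  · have h2 : t / T ∈ Ioo (0 : ℝ) 1 := ⟨div_pos ht.1 hT, (div_lt_one hT).2 ht.2⟩
    have e : toUnit (t / T) = ⟨t / T, Ioo_subset_Icc_self h2⟩ :=
      projIcc_of_mem _ (Ioo_subset_Icc_self h2)
    refine hn _ ?_ ?_ <;> rw [e]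
    · exact h2.1
    · exact h2.2

theorem isDisplacement_unique (hσ : A.IsCrossSection σ) {l : Fin 6 → ℝ} {h δ δ' : ℝ}
    (h1 : IsDisplacement A σ l h δ) (h2 : IsDisplacement A σ l h δ') : δ = δ' := by
  obtain ⟨k, hk, ⟨T, hT, γ, hγ, h0, he, hS, hn⟩, rfl⟩ := h1
  obtain ⟨k', hk', ⟨T', hT', γ', hγ', h0', he', hS', hn'⟩, rfl⟩ := h2
  obtain ⟨rfl, e⟩ := first_return_unique hT hT' hγ hγ' (h0.trans h0'.symm) (he ▸ hS) (he' ▸ hS')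
    hn hn'
  have : σ k = σ k' := by rw [← he, ← he', e (right_mem_Icc.2 hT.le)]
  rw [← hσ.ham_eq hk, ← hσ.ham_eq hk', this]

theorem displacement_eq (hσ : A.IsCrossSection σ) {l : Fin 6 → ℝ} {h δ : ℝ}
    (h1 : IsDisplacement A σ l h δ) : displacement A σ l h = δ := by
  have hd : ∃ δ, IsDisplacement A σ l h δ := ⟨δ, h1⟩
  rw [displacement, dif_pos hd]
  exact isDisplacement_unique hσ hd.choose_spec h1

end Section

/-! ### Parametrization of the ovals -/

/-- A scalar autonomous equation with positive bounded continuous right-hand side has a solution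
that is an increasing bijection of the line. -/
theorem exists_increasing_solution {w : ℝ → ℝ} (hw : Continuous w) (hpos : ∀ θ, 0 < w θ) {C : ℝ}
    (hC : ∀ θ, w θ ≤ C) :
    ∃ θ : ℝ → ℝ, (∀ t, HasDerivAt θ (w (θ t)) t) ∧ StrictMono θ ∧ Function.Surjective θ ∧
      θ 0 = 0 := by
  have hC0 : 0 < C := (hpos 0).trans_le (hC 0)
  have hci : Continuous fun φ => (w φ)⁻¹ := hw.inv₀ fun φ => (hpos φ).ne'
  -- The inverse solution: the time needed to reach the angle φ. The bound w ≤ C keeps its slope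
  -- above 1/C, hence it is onto.
  set τ : ℝ → ℝ := fun φ => ∫ s in (0 : ℝ)..φ, (w s)⁻¹ with hτ
  have hd : ∀ φ, HasDerivAt τ (w φ)⁻¹ φ := fun φ =>
    intervalIntegral.integral_hasDerivAt_right (hci.intervalIntegrable _ _)
      (hci.stronglyMeasurableAtFilter _ _) hci.continuousAt
  have hcont : Continuous τ := continuous_iff_continuousAt.2 fun φ => (hd φ).continuousAt
  have hmono : StrictMono τ := strictMono_of_deriv_pos fun φ => by
    rw [(hd φ).deriv]
    exact inv_pos.2 (hpos φ)
  have hm2 : Monotone fun φ => τ φ - C⁻¹ * φ := by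
    have hd2 : ∀ φ, HasDerivAt (fun φ => τ φ - C⁻¹ * φ) ((w φ)⁻¹ - C⁻¹) φ := fun φ => by
      simpa using (hd φ).fun_sub ((hasDerivAt_id φ).const_mul C⁻¹)
    refine monotone_of_deriv_nonneg (fun φ => (hd2 φ).differentiableAt) fun φ => ?_
    rw [(hd2 φ).deriv, sub_nonneg]
    exact inv_anti₀ (hpos φ) (hC φ)
  have h0 : τ 0 = 0 := by simp [hτ]
  have htop : Tendsto τ atTop atTop := by
    refine tendsto_atTop_mono' atTop ?_ (tendsto_id.const_mul_atTop (inv_pos.2 hC0))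
    filter_upwards [eventually_ge_atTop 0] with φ hφ
    have := hm2 hφ
    simp only [h0, mul_zero, sub_zero] at this
    simp only [id]
    linarith
  have hbot : Tendsto τ atBot atBot := by
    refine tendsto_atBot_mono' atBot ?_ (tendsto_id.const_mul_atBot (inv_pos.2 hC0))
    filter_upwards [eventually_le_atBot 0] with φ hφ
    have := hm2 hφ
    simp only [h0, mul_zero, sub_zero] at this
    simp only [id]
    linarith
  have hsurj : Function.Surjective τ := hcont.surjective htop hbot
  set e : ℝ ≃o ℝ := hmono.orderIsoOfSurjective τ hsurj
  have he : ∀ φ, e φ = τ φ := fun φ => rfl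
  refine ⟨e.symm, fun t => ?_, e.symm.strictMono, e.symm.surjective, ?_⟩
  · have h1 : HasDerivAt τ (w (e.symm t))⁻¹ (e.symm t) := hd _
    have := h1.of_local_left_inverse e.symm.continuous.continuousAt
      (inv_ne_zero (hpos _).ne') (Eventually.of_forall fun s => by
        rw [← he]; exact e.apply_symm_apply s)
    rwa [inv_inv] at this
  · rw [OrderIso.symm_apply_eq, he, h0]

theorem exists_cos_sin_eq {u v : ℝ} (h : u ^ 2 + v ^ 2 = 1) :
    ∃ θ ∈ Ico 0 (2 * Real.pi), Real.cos θ = u ∧ Real.sin θ = v := by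
  set z : ℂ := ⟨u, v⟩
  have hn : ‖z‖ = 1 := by
    rw [Complex.norm_def, Complex.normSq_mk, Real.sqrt_eq_one]
    linarith
  have hz : z ≠ 0 := by
    intro h0
    rw [h0, norm_zero] at hn
    exact zero_ne_one hn
  refine ⟨toIcoMod Real.two_pi_pos 0 z.arg, by simpa using toIcoMod_mem_Ico Real.two_pi_pos 0 z.arg,
    ?_, ?_⟩
  · rw [toIcoMod, zsmul_eq_mul, Real.cos_sub_int_mul_two_pi, Complex.cos_arg hz, hn, div_one]
  · rw [toIcoMod, zsmul_eq_mul, Real.sin_sub_int_mul_two_pi, Complex.sin_arg, hn, div_one]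

theorem eq_of_cos_eq_of_sin_eq {θ ψ : ℝ} (hθ : θ ∈ Ico 0 (2 * Real.pi))
    (hψ : ψ ∈ Ico 0 (2 * Real.pi)) (hc : Real.cos θ = Real.cos ψ) (hs : Real.sin θ = Real.sin ψ) :
    θ = ψ := by
  have h := Real.Angle.cos_sin_inj hc hs
  rw [Real.Angle.angle_eq_iff_two_pi_dvd_sub] at h
  obtain ⟨k, hk⟩ := h
  have hp := Real.two_pi_pos
  have h1 : (k : ℝ) < 1 := by
    by_contra! h1
    nlinarith [hθ.2, hψ.1]
  have h2 : (-1 : ℝ) < k := by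
    by_contra! h2
    nlinarith [hθ.1, hψ.2]
  have h3 : k = 0 := by
    have : k < 1 := by exact_mod_cast h1
    have : -1 < k := by exact_mod_cast h2
    omega
  rw [h3] at hk
  simp at hk
  linarith

/-- Ovals described by an angle `θ ↦ (X (sin θ), cos θ * Y (sin θ))` with angular velocity `w` are
periodic orbits. -/
theorem exists_isOvalParam_of_angle {A : PeriodAnnulus} {h : ℝ} {X Y w : ℝ → ℝ} {Z' : ℝ → ℝ × ℝ}
    (hw : Continuous w) (hpos : ∀ θ, 0 < w θ) {C : ℝ} (hC : ∀ θ, w θ ≤ C)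
    (hZ : ∀ θ, HasDerivAt (fun θ => (X (Real.sin θ), Real.cos θ * Y (Real.sin θ))) (Z' θ) θ)
    (hf : ∀ θ, w θ • Z' θ =
      A.hamCase.field 0 (X (Real.sin θ), Real.cos θ * Y (Real.sin θ)))
    (hX : InjOn X (Icc (-1) 1)) (hY : ∀ s ∈ Icc (-1 : ℝ) 1, Y s ≠ 0)
    (hmem : ∀ θ, (X (Real.sin θ), Real.cos θ * Y (Real.sin θ)) ∈ A.oval h)
    (hcov : ∀ z ∈ A.oval h, ∃ u v : ℝ, u ^ 2 + v ^ 2 = 1 ∧ z = (X v, u * Y v)) :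
    ∃ γ T, A.IsOvalParam h γ T := by
  obtain ⟨θ, hθ, hmono, hsurj, h0⟩ := exists_increasing_solution hw hpos hC
  obtain ⟨T, hT⟩ := hsurj (2 * Real.pi)
  have hT0 : 0 < T := by
    rw [← hmono.lt_iff_lt, h0, hT]
    exact Real.two_pi_pos
  have hmaps : ∀ t ∈ Ico 0 T, θ t ∈ Ico 0 (2 * Real.pi) := fun t ht =>
    ⟨by rw [← h0]; exact hmono.monotone ht.1, by rw [← hT]; exact hmono ht.2⟩
  refine ⟨fun t => (X (Real.sin (θ t)), Real.cos (θ t) * Y (Real.sin (θ t))), T, hT0, fun t => ?_,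
    ?_, fun s hs t ht hst => ?_, ?_⟩
  · have := (hZ (θ t)).scomp t (hθ t)
    rw [hf] at this
    exact this
  · simp [hT, h0]
  · have h1 := congrArg Prod.fst hst
    have h2 := congrArg Prod.snd hst
    simp only at h1 h2
    have hm : ∀ x, Real.sin x ∈ Icc (-1 : ℝ) 1 := fun x => ⟨Real.neg_one_le_sin x, Real.sin_le_one x⟩
    have h3 := hX (hm _) (hm _) h1
    rw [h3] at h2
    have h4 := mul_right_cancel₀ (hY _ (hm _)) h2
    exact hmono.injective (eq_of_cos_eq_of_sin_eq (hmaps s hs) (hmaps t ht) h4 h3)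
  · apply Subset.antisymm
    · rintro _ ⟨t, _, rfl⟩
      exact hmem _
    · intro z hz
      obtain ⟨u, v, huv, rfl⟩ := hcov z hz
      obtain ⟨φ, hφ, rfl, rfl⟩ := exists_cos_sin_eq huv
      obtain ⟨t, rfl⟩ := hsurj φ
      refine ⟨t, ⟨?_, ?_⟩, rfl⟩
      · rw [← hmono.le_iff_le, h0]
        exact hφ.1
      · rw [← hmono.lt_iff_lt, hT]
        exact hφ.2

/-- By `hc` and `hrc` the level curve is 2y² = (r² - x²)(c + b x²). Put x = r sin θ, y = r W cos θ
with W² = (c + b x²)/2; then x' = y amounts to θ' = W. The hypothesis `hoval` excludes the unbounded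
branches of the pendulum. -/
theorem exists_isOvalParam_of_even {A : PeriodAnnulus} {h r c : ℝ} (hr : 0 < r)
    (hc : c - A.hamCase.b * r ^ 2 = 2 * A.hamCase.a) (hrc : r ^ 2 * c = 4 * h)
    (hpos : ∀ x, x ^ 2 ≤ r ^ 2 → 0 < c + A.hamCase.b * x ^ 2)
    (hoval : ∀ z ∈ A.oval h, 0 < c + A.hamCase.b * z.1 ^ 2)
    (hstrip : ∀ x, x ^ 2 ≤ r ^ 2 → x ∈ A.strip) : ∃ γ T, A.IsOvalParam h γ T := by
  set a := A.hamCase.a with ha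
  set b := A.hamCase.b with hb
  set W : ℝ → ℝ := fun s => √((c + b * (r * s) ^ 2) / 2) with hW
  have hle : ∀ θ, (r * Real.sin θ) ^ 2 ≤ r ^ 2 := fun θ => by
    rw [mul_pow]
    exact mul_le_of_le_one_right (by positivity) (Real.sin_sq_le_one θ)
  have hp : ∀ θ, 0 < (c + b * (r * Real.sin θ) ^ 2) / 2 := fun θ => half_pos (hpos _ (hle θ))
  have hWp : ∀ θ, 0 < W (Real.sin θ) := fun θ => Real.sqrt_pos.2 (hp θ)
  have hWsq : ∀ θ, W (Real.sin θ) ^ 2 = (c + b * (r * Real.sin θ) ^ 2) / 2 := fun θ =>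
    Real.sq_sqrt (hp θ).le
  have hs : ∀ s ∈ Icc (-1 : ℝ) 1, ∃ θ, Real.sin θ = s := fun s hs =>
    ⟨Real.arcsin s, Real.sin_arcsin hs.1 hs.2⟩
  refine exists_isOvalParam_of_angle (X := fun s => r * s) (Y := fun s => r * W s)
    (w := fun θ => W (Real.sin θ)) (C := √((|c| + |b| * r ^ 2) / 2))
    (Z' := fun θ => (r * Real.cos θ, -Real.sin θ * (r * W (Real.sin θ)) + Real.cos θ *
      (r * (b * r ^ 2 * Real.sin θ * Real.cos θ / (2 * W (Real.sin θ))))))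
    (by fun_prop) hWp (fun θ => ?_) (fun θ => ?_) (fun θ => ?_) ?_ (fun s hs' => ?_) (fun θ => ?_)
    (fun z hz => ?_)
  · refine Real.sqrt_le_sqrt (div_le_div_of_nonneg_right (add_le_add (le_abs_self c) ?_) (by norm_num))
    exact mul_le_mul (le_abs_self b) (hle θ) (sq_nonneg _) (abs_nonneg b)
  · have h1 : HasDerivAt (fun θ => r * Real.sin θ) (r * Real.cos θ) θ :=
      (Real.hasDerivAt_sin θ).const_mul r
    have h2 : HasDerivAt (fun θ => W (Real.sin θ))
        (b * r ^ 2 * Real.sin θ * Real.cos θ / (2 * W (Real.sin θ))) θ := by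
      have h3 : HasDerivAt (fun θ => (c + b * (r * Real.sin θ) ^ 2) / 2)
          (b * r ^ 2 * Real.sin θ * Real.cos θ) θ := by
        refine ((((h1.fun_pow 2).const_mul b).const_add c).div_const 2).congr_deriv ?_
        simp
        ring
      exact h3.sqrt (hp θ).ne'
    exact h1.prodMk ((Real.hasDerivAt_cos θ).fun_mul (h2.const_mul r))
  · have hne := (hWp θ).ne'
    simp only [HamCase.field, Prod.smul_mk, smul_eq_mul, Pi.zero_apply]
    refine Prod.ext (by simp only; ring) ?_
    have hcs := Real.sin_sq_add_cos_sq θ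
    have h1 := hWsq θ
    simp only [← ha, ← hb]
    have h2 : W (Real.sin θ) * (-Real.sin θ * (r * W (Real.sin θ)) + Real.cos θ *
        (r * (b * r ^ 2 * Real.sin θ * Real.cos θ / (2 * W (Real.sin θ))))) =
        -Real.sin θ * r * W (Real.sin θ) ^ 2 + r * b * r ^ 2 * Real.sin θ * Real.cos θ ^ 2 / 2 := by
      field_simp
    rw [h2, h1]
    linear_combination (r * b * r ^ 2 * Real.sin θ / 2) * hcs - r * Real.sin θ / 2 * hc
  · intro s _ t _ hst
    exact mul_left_cancel₀ hr.ne' hst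
  · obtain ⟨θ, rfl⟩ := hs s hs'
    exact (mul_pos hr (hWp θ)).ne'
  · refine ⟨hstrip _ (hle θ), ?_⟩
    have hcs := Real.sin_sq_add_cos_sq θ
    have h1 := hWsq θ
    simp only [HamCase.ham, ← ha, ← hb]
    have e : (Real.cos θ * (r * W (Real.sin θ))) ^ 2 =
      (1 - Real.sin θ ^ 2) * r ^ 2 * W (Real.sin θ) ^ 2 := by
        rw [← hcs]; ring
    rw [e, h1]
    linear_combination (1 / 4) * hrc - r ^ 2 * Real.sin θ ^ 2 / 4 * hc
  · obtain ⟨x, y⟩ := z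
    have hxp := hoval _ hz
    obtain ⟨-, hH⟩ := hz
    simp only [HamCase.ham, ← ha, ← hb] at hH hxp
    have hq : 0 < (c + b * x ^ 2) / 2 := half_pos hxp
    have hw0 : 0 < √((c + b * x ^ 2) / 2) := Real.sqrt_pos.2 hq
    have hw2 := Real.sq_sqrt hq.le
    have hrx : r * (x / r) = x := by field_simp
    refine ⟨y / (r * √((c + b * x ^ 2) / 2)), x / r, ?_, ?_⟩
    · rw [div_pow, mul_pow, hw2, div_pow, div_add_div _ _ (by positivity) (by positivity),
        div_eq_one_iff_eq (by positivity)]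
      linear_combination (2 * r ^ 2) * hH - r ^ 2 / 2 * hrc + r ^ 2 * x ^ 2 / 2 * hc
    · simp only [hW, hrx]
      refine Prod.ext rfl ?_
      field_simp

/-- The level curve is (x² - 1)² + 2y² = 4h + 1 = ρ², so x² = 1 + ρ sin θ and √2 y = eρ cos θ. The
sign e chooses the loop; its presence in y as well lets θ increase along the flow in both loops. -/
theorem exists_isOvalParam_of_eight {A : PeriodAnnulus} {h e : ℝ} (he : e ^ 2 = 1)
    (hcase : A.hamCase = .eightLoop) (hh : h ∈ Ioo (-1 / 4 : ℝ) 0)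
    (hstrip : A.strip = {x | 0 < e * x}) : ∃ γ T, A.IsOvalParam h γ T := by
  have ha : A.hamCase.a = -1 := by rw [hcase]; rfl
  have hb : A.hamCase.b = 1 := by rw [hcase]; rfl
  have hρ0 : 0 < 4 * h + 1 := by linarith [hh.1]
  obtain ⟨ρ, hρ, hρ2⟩ : ∃ ρ : ℝ, 0 < ρ ∧ ρ ^ 2 = 4 * h + 1 :=
    ⟨_, Real.sqrt_pos.2 hρ0, Real.sq_sqrt hρ0.le⟩
  have hρ1 : ρ < 1 := by nlinarith [hh.2]
  have he0 : e ≠ 0 := fun h0 => by rw [h0] at he; norm_num at he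
  have hp' : ∀ s ∈ Icc (-1 : ℝ) 1, 0 < 1 + ρ * s := fun s hs => by nlinarith [hs.1]
  have hp : ∀ θ, 0 < 1 + ρ * Real.sin θ := fun θ =>
    hp' _ ⟨Real.neg_one_le_sin θ, Real.sin_le_one θ⟩
  have h2 : √2 ^ 2 = (2 : ℝ) := Real.sq_sqrt (by norm_num)
  have h20 : 0 < √(2 : ℝ) := by positivity
  have hR : ∀ θ, 0 < √(1 + ρ * Real.sin θ) := fun θ => Real.sqrt_pos.2 (hp θ)
  have hR2 : ∀ θ, √(1 + ρ * Real.sin θ) ^ 2 = 1 + ρ * Real.sin θ := fun θ => Real.sq_sqrt (hp θ).le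
  refine exists_isOvalParam_of_angle (X := fun s => e * √(1 + ρ * s)) (Y := fun _ => e * ρ / √2)
    (w := fun θ => √2 * √(1 + ρ * Real.sin θ)) (C := √2 * √(1 + ρ))
    (Z' := fun θ => (e * (ρ * Real.cos θ / (2 * √(1 + ρ * Real.sin θ))),
      -Real.sin θ * (e * ρ / √2)))
    (by fun_prop) (fun θ => mul_pos h20 (hR θ)) (fun θ => ?_) (fun θ => ?_) (fun θ => ?_) ?_
    (fun s _ => by positivity) (fun θ => ?_) (fun z hz => ?_)
  · refine mul_le_mul_of_nonneg_left (Real.sqrt_le_sqrt ?_) h20.le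
    nlinarith [Real.sin_le_one θ]
  · have h1 : HasDerivAt (fun θ => 1 + ρ * Real.sin θ) (ρ * Real.cos θ) θ :=
      ((Real.hasDerivAt_sin θ).const_mul ρ).const_add 1
    exact ((h1.sqrt (hp θ).ne').const_mul e).prodMk ((Real.hasDerivAt_cos θ).mul_const _)
  · have hne := (hR θ).ne'
    simp only [HamCase.field, Prod.smul_mk, smul_eq_mul, Pi.zero_apply, ha, hb]
    have h3 := hR2 θ
    set R := √(1 + ρ * Real.sin θ)
    refine Prod.ext ?_ ?_
    · simp only
      field_simp
      linear_combination Real.cos θ * h2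
    · simp only
      have e1 : √2 * R * (-Real.sin θ * (e * ρ / √2)) = -(R * Real.sin θ * e * ρ) := by
        field_simp
      rw [e1]
      linear_combination e * R ^ 3 * he + e * R * h3
  · intro s hs t ht hst
    have h3 := mul_left_cancel₀ he0 hst
    have h4 := (Real.sqrt_inj (hp' s hs).le (hp' t ht).le).1 h3
    exact mul_left_cancel₀ hρ.ne' (add_left_cancel h4)
  · constructor
    · rw [hstrip]
      simp only [mem_ofPred_eq, ← mul_assoc, ← sq, he, one_mul]
      exact hR θ
    · have hcs := Real.sin_sq_add_cos_sq θ
      simp only [HamCase.ham, ha, hb]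
      have h3 := hR2 θ
      set R := √(1 + ρ * Real.sin θ)
      have e1 : (Real.cos θ * (e * ρ / √2)) ^ 2 = Real.cos θ ^ 2 * ρ ^ 2 / 2 := by
        rw [mul_pow, div_pow, mul_pow, he, h2]; ring
      have e2 : (e * R) ^ 2 = 1 + ρ * Real.sin θ := by rw [mul_pow, he, h3, one_mul]
      have e3 : (e * R) ^ 4 = (1 + ρ * Real.sin θ) ^ 2 := by rw [← e2]; ring
      rw [e1, e2, e3]
      linear_combination ρ ^ 2 / 4 * hcs + hρ2 / 4
  · obtain ⟨x, y⟩ := z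
    obtain ⟨hx, hH⟩ := hz
    rw [hstrip] at hx
    simp only [mem_ofPred_eq] at hx
    simp only [HamCase.ham, ha, hb] at hH
    have hxx : 1 + ρ * ((x ^ 2 - 1) / ρ) = (e * x) ^ 2 := by
      rw [mul_pow, he]
      field_simp
      ring
    refine ⟨e * √2 * y / ρ, (x ^ 2 - 1) / ρ, ?_, ?_⟩
    · rw [div_pow, div_pow, mul_pow, mul_pow, he, h2, ← add_div, div_eq_one_iff_eq (by positivity)]
      linear_combination 4 * hH - hρ2
    · simp only [hxx, Real.sqrt_sq hx.le]
      refine Prod.ext ?_ ?_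
      · simp only
        linear_combination -x * he
      · simp only
        field_simp
        linear_combination -y * he

theorem exists_isOvalParam (A : PeriodAnnulus) {h : ℝ} (hh : h ∈ A.levels) :
    ∃ γ T, A.IsOvalParam h γ T := by
  cases A with
  | globalCenter =>
    have hh : 0 < h := hh
    -- In this and the other even cases, r² and c come from the roots in x² of 2a x² + b x⁴ = 4h,
    -- which is y = 0.
    obtain ⟨D, hD, hD2⟩ : ∃ D : ℝ, 1 < D ∧ D ^ 2 = 1 + 4 * h :=
      ⟨√(1 + 4 * h), by rw [Real.lt_sqrt] <;> linarith, Real.sq_sqrt (by linarith)⟩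
    have hr2 : √(D - 1) ^ 2 = D - 1 := Real.sq_sqrt (by linarith)
    refine exists_isOvalParam_of_even (r := √(D - 1)) (c := D + 1) (Real.sqrt_pos.2 (by linarith))
      ?_ ?_ ?_ ?_ (fun _ _ => mem_univ _) <;>
      simp only [PeriodAnnulus.hamCase, HamCase.a, HamCase.b, hr2]
    · ring
    · linear_combination hD2
    · intro x _
      positivity
    · intro z _
      positivity
  | truncatedPendulum =>
    have hh : h ∈ Ioo (0 : ℝ) (1 / 4) := hh
    obtain ⟨D, hD0, hD2⟩ : ∃ D : ℝ, 0 < D ∧ D ^ 2 = 1 - 4 * h :=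
      ⟨√(1 - 4 * h), Real.sqrt_pos.2 (by linarith [hh.2]), Real.sq_sqrt (by linarith [hh.2])⟩
    have hD1 : D < 1 := by nlinarith [hh.1]
    have hr2 : √(1 - D) ^ 2 = 1 - D := Real.sq_sqrt (by linarith)
    refine exists_isOvalParam_of_even (r := √(1 - D)) (c := 1 + D) (Real.sqrt_pos.2 (by linarith))
      ?_ ?_ ?_ ?_ ?_ <;>
      simp only [PeriodAnnulus.hamCase, HamCase.a, HamCase.b, hr2]
    · ring
    · linear_combination -hD2
    · intro x hx
      linarith
    · rintro z ⟨⟨h1, h2⟩, -⟩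
      nlinarith
    · intro x hx
      simp only [PeriodAnnulus.strip, mem_Ioo]
      constructor <;> nlinarith
  | eightRight =>
    exact exists_isOvalParam_of_eight (e := 1) (by norm_num) rfl hh (by
      ext x; simp [PeriodAnnulus.strip])
  | eightLeft =>
    exact exists_isOvalParam_of_eight (e := -1) (by norm_num) rfl hh (by
      ext x; simp [PeriodAnnulus.strip])
  | eightExterior =>
    have hh : 0 < h := hh
    obtain ⟨D, hD, hD2⟩ : ∃ D : ℝ, 1 < D ∧ D ^ 2 = 1 + 4 * h :=
      ⟨√(1 + 4 * h), by rw [Real.lt_sqrt] <;> linarith, Real.sq_sqrt (by linarith)⟩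
    have hr2 : √(D + 1) ^ 2 = D + 1 := Real.sq_sqrt (by linarith)
    refine exists_isOvalParam_of_even (r := √(D + 1)) (c := D - 1) (Real.sqrt_pos.2 (by linarith))
      ?_ ?_ ?_ ?_ (fun _ _ => mem_univ _) <;>
      simp only [PeriodAnnulus.hamCase, HamCase.a, HamCase.b, hr2]
    · ring
    · linear_combination hD2
    · intro x _
      nlinarith [sq_nonneg x]
    · intro z _
      nlinarith [sq_nonneg z.1]

/-! ### Periodicity, change of base point, oval integrals -/

theorem deriv_fst_of_solution {c : HamCase} {l : Fin 6 → ℝ} {γ : ℝ → ℝ × ℝ} {t : ℝ} {z : ℝ × ℝ}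
    (h : HasDerivAt γ (c.field l z) t) : deriv (fun s => (γ s).1) t = z.2 :=
  ((ContinuousLinearMap.fst ℝ ℝ ℝ).hasFDerivAt.comp_hasDerivAt t h).deriv

/-- Uniqueness of solutions makes every oval parametrization periodic on the whole line. -/
theorem PeriodAnnulus.IsOvalParam.periodic {A : PeriodAnnulus} {h T : ℝ} {γ : ℝ → ℝ × ℝ}
    (hγ : A.IsOvalParam h γ T) : Function.Periodic γ T := by
  obtain ⟨-, hd, he, -, -⟩ := hγ
  have h1 : ∀ t, HasDerivAt (fun t => γ (t + T)) (A.hamCase.field 0 (γ (t + T))) t := fun t =>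
    (hd (t + T)).comp_add_const t T
  have := ode_unique ((contDiff_field A.hamCase 0).of_le (by simp)) h1 hd (by simpa using he)
  exact fun t => congrFun this t

/-- Every oval has a parametrization starting at a prescribed point, with the same integrals. -/
theorem PeriodAnnulus.IsOvalParam.rebase {A : PeriodAnnulus} {h T : ℝ} {γ : ℝ → ℝ × ℝ}
    (hγ : A.IsOvalParam h γ T) {z : ℝ × ℝ} (hz : z ∈ A.oval h) :
    ∃ δ : ℝ → ℝ × ℝ, (∀ t, HasDerivAt δ (A.hamCase.field 0 (δ t)) t) ∧ δ 0 = z ∧ δ T = z ∧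
      (∀ t ∈ Ioo 0 T, δ t ≠ z) ∧ (∀ t, δ t ∈ A.oval h) ∧
      ∀ k, ovalIntegral k δ T = ovalIntegral k γ T := by
  have hper := hγ.periodic
  obtain ⟨hT, hd, he, hinj, himg⟩ := hγ
  obtain ⟨t₀, ht₀, rfl⟩ : z ∈ γ '' Ico 0 T := himg ▸ hz
  refine ⟨fun t => γ (t + t₀), fun t => (hd (t + t₀)).comp_add_const t t₀, by simp, ?_, ?_, ?_, ?_⟩
  · simp only
    rw [add_comm]
    exact hper t₀
  · intro t ht hne
    simp only at hne
    by_cases hlt : t + t₀ < T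
    · have := hinj ⟨by linarith [ht.1, ht₀.1], hlt⟩ ht₀ hne
      linarith [ht.1]
    · rw [← hper.sub_eq] at hne
      have := hinj ⟨by linarith, by linarith [ht.2, ht₀.2]⟩ ht₀ hne
      linarith [ht.2]
  · intro t
    obtain ⟨s, hs, hst⟩ := hper.exists_mem_Ico₀ hT (t + t₀)
    simp only
    rw [hst, ← himg]
    exact mem_image_of_mem _ hs
  · intro k
    have hdx : ∀ t, deriv (fun s => (γ s).1) t = (γ t).2 := fun t => deriv_fst_of_solution (hd t)
    have hdx' : ∀ t, deriv (fun s => (γ (s + t₀)).1) t = (γ (t + t₀)).2 := fun t =>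
      deriv_fst_of_solution ((hd (t + t₀)).comp_add_const t t₀)
    simp only [ovalIntegral, hdx, hdx']
    have hp2 : Function.Periodic (fun t => (γ t).1 ^ k * (γ t).2 * (γ t).2) T := fun t => by
      simp only [hper t]
    rw [intervalIntegral.integral_comp_add_right (fun t => (γ t).1 ^ k * (γ t).2 * (γ t).2) t₀,
      zero_add, add_comm T t₀, hp2.intervalIntegral_add_eq t₀ 0, zero_add]

/-- The oval integrals in terms of the rescaled path. -/
theorem ovalIntegral_eq {c : HamCase} {γ : ℝ → ℝ × ℝ} (hc : Continuous γ)
    (hd : ∀ t, HasDerivAt γ (c.field 0 (γ t)) t) (k : ℕ) (T : ℝ) :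
    ovalIntegral k γ T = T * integral01 ((samplePath γ hc T).1 ^ k * (samplePath γ hc T).2 ^ 2) := by
  have hdx : ∀ t, deriv (fun s => (γ s).1) t = (γ t).2 := fun t => deriv_fst_of_solution (hd t)
  have h1 := intervalIntegral.mul_integral_comp_mul_left (a := (0 : ℝ)) (b := 1)
    (f := fun t => (γ t).1 ^ k * (γ t).2 * (γ t).2) T
  simp only [ovalIntegral, hdx]
  rw [mul_zero, mul_one] at h1
  rw [← h1, integral01_apply]
  congr 1
  refine intervalIntegral.integral_congr fun t ht => ?_
  rw [uIcc_of_le zero_le_one] at ht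
  have e : toUnit t = ⟨t, ht⟩ := projIcc_of_mem _ ht
  simp only [e, samplePath, ContinuousMap.mul_apply, ContinuousMap.pow_apply, ContinuousMap.coe_mk]
  ring

/-- An unperturbed orbit through a point of the section avoids the section until it closes up. -/
theorem not_mem_section_of_ne {A : PeriodAnnulus} {σ : ℝ → ℝ × ℝ} (hσ : A.IsCrossSection σ) {h : ℝ}
    {z : ℝ × ℝ} (hz : z ∈ A.oval h) (hne : z ≠ σ h) : z ∉ σ '' A.levels := fun hmem => by
  have := (hσ.eq_of_mem hmem).2
  rw [hz.2] at this
  exact hne this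

/-! ### Taylor coefficients and division by powers -/

/-- Taylor coefficients of `ε ^ n * g ε` up to order `n`. -/
theorem taylorCoeff_pow_mul {g : ℝ → ℝ} (hg : AnalyticAt ℝ g 0) (n k : ℕ) (hk : k ≤ n) :
    taylorCoeff (fun ε => ε ^ n * g ε) k = if k = n then g 0 else 0 := by
  have h : iteratedDeriv k (fun ε => ε ^ n * g ε) 0 =
      ∑ i ∈ Finset.range (k + 1), (k.choose i : ℝ) * iteratedDeriv i (fun ε : ℝ => ε ^ n) 0 *
        iteratedDeriv (k - i) g 0 :=
    iteratedDeriv_fun_mul (analyticAt_id.pow n).contDiffAt hg.contDiffAt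
  rw [taylorCoeff, h, Finset.sum_eq_single k]
  · rw [iteratedDeriv_fun_pow_zero]
    split_ifs with he
    · subst he
      have : (k.factorial : ℝ) ≠ 0 := by positivity
      simp
      field_simp
    · simp
  · intro i hi hne
    have : i ≠ n := by
      have := Finset.mem_range.1 hi
      omega
    rw [iteratedDeriv_fun_pow_zero, if_neg this]
    simp
  · intro h
    simp at h

theorem taylorCoeff_congr {f g : ℝ → ℝ} (h : f =ᶠ[𝓝 0] g) (k : ℕ) :
    taylorCoeff f k = taylorCoeff g k := by
  rw [taylorCoeff, taylorCoeff, h.iteratedDeriv_eq]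

/-- An analytic function whose Taylor coefficients of order less than `n` vanish is divisible by
`ε ^ n`, the quotient being the coefficient of order `n` at `0`. -/
theorem exists_eq_pow_mul {f : ℝ → ℝ} (hf : AnalyticAt ℝ f 0) {n : ℕ}
    (h : ∀ k < n, taylorCoeff f k = 0) :
    ∃ g, AnalyticAt ℝ g 0 ∧ (∀ᶠ ε in 𝓝 0, f ε = ε ^ n * g ε) ∧ g 0 = taylorCoeff f n := by
  have h1 : (n : ℕ∞) ≤ analyticOrderAt f 0 := by
    rw [natCast_le_analyticOrderAt_iff_iteratedDeriv_eq_zero hf]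
    intro i hi
    have := h i hi
    rw [taylorCoeff, div_eq_zero_iff] at this
    exact this.resolve_right (by positivity)
  obtain ⟨g, hg, hfg⟩ := (natCast_le_analyticOrderAt hf).1 h1
  simp only [sub_zero, smul_eq_mul] at hfg
  exact ⟨g, hg, hfg, by rw [taylorCoeff_congr hfg, taylorCoeff_pow_mul hg n n le_rfl, if_pos rfl]⟩

/-- The leading Taylor coefficient of an analytic function of the form `ε ^ n * F ε` with `F`
merely continuous at `0`. -/
theorem taylorCoeff_of_eq_pow_mul {f F : ℝ → ℝ} (hf : AnalyticAt ℝ f 0) {n : ℕ}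
    (hF : ContinuousAt F 0) (h : ∀ᶠ ε in 𝓝 0, f ε = ε ^ n * F ε) :
    taylorCoeff f n = F 0 := by
  -- The factor `0 ^ (n - m)` is 1 for m = n and 0 otherwise. Once the lower coefficients vanish,
  -- cancelling ε^m away from 0 and letting ε tend to 0 gives the coefficient of order m.
  have hk : ∀ m ≤ n, (∀ k < m, taylorCoeff f k = 0) ∧ taylorCoeff f m = 0 ^ (n - m) * F 0 := by
    intro m hm
    induction m using Nat.strong_induction_on with
    | _ m ih =>
      have hz : ∀ k < m, taylorCoeff f k = 0 := fun k hk => by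
        rw [(ih k hk (hk.le.trans hm)).2, zero_pow (by omega), zero_mul]
      refine ⟨hz, ?_⟩
      obtain ⟨g, hg, hfg, hg0⟩ := exists_eq_pow_mul hf hz
      rw [← hg0]
      have e : ∀ᶠ ε in 𝓝[≠] (0 : ℝ), g ε = ε ^ (n - m) * F ε := by
        filter_upwards [hfg.filter_mono nhdsWithin_le_nhds, h.filter_mono nhdsWithin_le_nhds,
          self_mem_nhdsWithin] with ε h1 h2 hε
        have hε : ε ≠ 0 := hε
        have : ε ^ n = ε ^ m * ε ^ (n - m) := by rw [← pow_add]; congr 1; omega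
        rw [h1, this, mul_assoc] at h2
        exact mul_left_cancel₀ (pow_ne_zero m hε) h2
      have t1 : Tendsto g (𝓝[≠] 0) (𝓝 (g 0)) := hg.continuousAt.tendsto.mono_left nhdsWithin_le_nhds
      have t2 : Tendsto (fun ε : ℝ => ε ^ (n - m) * F ε) (𝓝[≠] 0) (𝓝 (0 ^ (n - m) * F 0)) :=
        ((continuousAt_id.pow (n - m)).mul hF).tendsto.mono_left nhdsWithin_le_nhds
      exact tendsto_nhds_unique t1 (t2.congr' (e.mono fun _ h => h.symm))
  simpa using (hk n le_rfl).2

/-! ### Relative exactness: the increment of H and the reduction of integrals -/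

/-- The factor of `y` in the perturbation, along a path. -/
def dampPath (l : Fin 6 → ℝ) (x y : C(unitInterval, ℝ)) : C(unitInterval, ℝ) :=
  l 0 • 1 + l 1 • x ^ 2 + l 2 • y ^ 2 + l 3 • x ^ 4 + l 4 • y ^ 4 + l 5 • x ^ 6

theorem fieldPath_eq (c : HamCase) (l : Fin 6 → ℝ) (x y : C(unitInterval, ℝ)) :
    fieldPath c l x y = -(c.a • x + c.b • x ^ 3) + dampPath l x y * y := rfl

/-- The derivative along `X_l` of the monomial `x ^ i * y ^ j`, on a path. -/
def monoDeriv (c : HamCase) (l : Fin 6 → ℝ) (i j : ℕ) (x y : C(unitInterval, ℝ)) :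
    C(unitInterval, ℝ) :=
  (i : ℝ) • (x ^ (i - 1) * y ^ (j + 1)) + (j : ℝ) • (x ^ i * y ^ (j - 1) * fieldPath c l x y)

section Solution

variable {c : HamCase} {T : ℝ} {z : ℝ × ℝ} {l : Fin 6 → ℝ}
  {g : PlanePath}

theorem IsSol.pathDeriv_monomial (h : IsSol c T z l g) (i j : ℕ) :
    PathDeriv (g.1 ^ i * g.2 ^ j) (T • monoDeriv c l i j g.1 g.2) := by
  refine ((h.deriv_fst.pow i).mul (h.deriv_snd.pow j)).congr_right ?_
  ext s
  simp [monoDeriv]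
  ring

theorem IsSol.integral_monoDeriv (h : IsSol c T z l g) (i j : ℕ) :
    T * integral01 (monoDeriv c l i j g.1 g.2) =
      (pathEval g 1).1 ^ i * (pathEval g 1).2 ^ j - z.1 ^ i * z.2 ^ j := by
  have := (h.pathDeriv_monomial i j).integral01_eq
  rw [map_smul, smul_eq_mul] at this
  rw [this, ← h.start]
  simp [pathEval]

theorem IsSol.integral_monoDeriv_closed (h : IsSol c T z l g) (hT : T ≠ 0) (hz : pathEval g 1 = z)
    (i j : ℕ) : integral01 (monoDeriv c l i j g.1 g.2) = 0 := by
  have := h.integral_monoDeriv i j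
  rw [hz, sub_self] at this
  exact (mul_eq_zero.1 this).resolve_left hT

theorem integral01_eq_of_sub {u v w : C(unitInterval, ℝ)} {p q : ℝ} {f : C(unitInterval, ℝ)}
    (hf : integral01 f = 0) (h : ∀ s, u s = p * v s + q * w s + f s) :
    integral01 u = p * integral01 v + q * integral01 w := by
  have e : u = p • v + q • w + f := by
    ext s
    simp [h s]
  rw [e]
  simp [hf]

/-- Reduction of the first order integrals to `I_2` and `I_0`. -/
theorem IsSol.integral_damp (h : IsSol c T z 0 g) (hT : T ≠ 0) (hz : pathEval g 1 = z) {E : ℝ}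
    (hE : ∀ s, c.ham (pathEval g s) = E) (l : Fin 6 → ℝ) :
    integral01 (dampPath l g.1 g.2 * g.2 ^ 2) =
      (linP c l).eval E * integral01 (g.1 ^ 2 * g.2 ^ 2) +
      (linQ c l).eval E * integral01 (g.1 ^ 0 * g.2 ^ 2) := by
  have hm := h.integral_monoDeriv_closed hT hz
  cases c with
  | globalCenter =>
    -- In all three cases the correction combines the derivatives of xy³, xy⁵, x³y³ and x⁵y³ along
    -- the flow, which integrate to zero on a closed orbit. Its coefficients solve the linear system
    -- obtained by matching monomials after H is substituted for E.
    refine integral01_eq_of_sub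
      (f := (1 / 7 * l 2 - 2 / 7 * l 3 - 10 / 231 * l 4 + 8 / 21 * l 5) •
          monoDeriv .globalCenter 0 1 3 g.1 g.2 + (17 / 77 * l 4) •
          monoDeriv .globalCenter 0 1 5 g.1 g.2 + (5 / 63 * l 4 - 2 / 9 * l 5) •
          monoDeriv .globalCenter 0 3 3 g.1 g.2 + (5 / 77 * l 4) •
          monoDeriv .globalCenter 0 5 3 g.1 g.2) (by simp [hm]) fun s => ?_
    rw [← hE s]
    simp [linP, linQ, dampPath, monoDeriv, fieldPath, HamCase.ham, pathEval, HamCase.a, HamCase.b]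
    ring
  | truncatedPendulum =>
    refine integral01_eq_of_sub
      (f := (1 / 7 * l 2 + 2 / 7 * l 3 + 10 / 231 * l 4 + 8 / 21 * l 5) •
          monoDeriv .truncatedPendulum 0 1 3 g.1 g.2 + (17 / 77 * l 4) •
          monoDeriv .truncatedPendulum 0 1 5 g.1 g.2 + (5 / 63 * l 4 + 2 / 9 * l 5) •
          monoDeriv .truncatedPendulum 0 3 3 g.1 g.2 + (-5 / 77 * l 4) •
          monoDeriv .truncatedPendulum 0 5 3 g.1 g.2) (by simp [hm]) fun s => ?_
    rw [← hE s]
    simp [linP, linQ, dampPath, monoDeriv, fieldPath, HamCase.ham, pathEval, HamCase.a, HamCase.b]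
    ring
  | eightLoop =>
    refine integral01_eq_of_sub
      (f := (1 / 7 * l 2 - 2 / 7 * l 3 - 10 / 231 * l 4 - 8 / 21 * l 5) •
          monoDeriv .eightLoop 0 1 3 g.1 g.2 + (17 / 77 * l 4) •
          monoDeriv .eightLoop 0 1 5 g.1 g.2 + (-5 / 63 * l 4 - 2 / 9 * l 5) •
          monoDeriv .eightLoop 0 3 3 g.1 g.2 + (5 / 77 * l 4) •
          monoDeriv .eightLoop 0 5 3 g.1 g.2) (by simp [hm]) fun s => ?_
    rw [← hE s]
    simp [linP, linQ, dampPath, monoDeriv, fieldPath, HamCase.ham, pathEval, HamCase.a, HamCase.b]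
    ring

/-- The weight `q² + q₂` of the third order term. -/
def cubicWeight (c : HamCase) (x y : C(unitInterval, ℝ)) : C(unitInterval, ℝ) :=
  (6 : ℝ) • (x ^ 2 * y ^ 2) - (3 / 2 * c.a) • x ^ 4 - c.b • x ^ 6

/-- Reduction of the third order integral to `I_2` and `I_0`. -/
theorem IsSol.integral_cubic (h : IsSol c T z 0 g) (hT : T ≠ 0) (hz : pathEval g 1 = z) {E : ℝ}
    (hE : ∀ s, c.ham (pathEval g s) = E) :
    integral01 (cubicWeight c g.1 g.2 * monoDeriv c 0 1 3 g.1 g.2) =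
      (cubP c).eval E * integral01 (g.1 ^ 2 * g.2 ^ 2) +
      (cubQ c).eval E * integral01 (g.1 ^ 0 * g.2 ^ 2) := by
  have hm := h.integral_monoDeriv_closed hT hz
  cases c with
  | globalCenter =>
    -- Same method in higher degree, with x³y⁵ and x⁷y³ in addition.
    refine integral01_eq_of_sub
      (f := (-48 / 1001 : ℝ) • monoDeriv .globalCenter 0 1 3 g.1 g.2 +
        (-160 / 1001 : ℝ) • monoDeriv .globalCenter 0 1 5 g.1 g.2 +
        (-12 / 91 : ℝ) • monoDeriv .globalCenter 0 3 3 g.1 g.2 +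
        (86 / 39 : ℝ) • monoDeriv .globalCenter 0 3 5 g.1 g.2 +
        (-9853 / 6006 : ℝ) • monoDeriv .globalCenter 0 5 3 g.1 g.2 +
        (-41 / 39 : ℝ) • monoDeriv .globalCenter 0 7 3 g.1 g.2) (by simp [hm]) fun s => ?_
    rw [← hE s]
    simp [cubP, cubQ, cubicWeight, monoDeriv, fieldPath, HamCase.ham, pathEval, HamCase.a,
      HamCase.b]
    ring
  | truncatedPendulum =>
    refine integral01_eq_of_sub
      (f := (-48 / 1001 : ℝ) • monoDeriv .truncatedPendulum 0 1 3 g.1 g.2 +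
        (160 / 1001 : ℝ) • monoDeriv .truncatedPendulum 0 1 5 g.1 g.2 +
        (12 / 91 : ℝ) • monoDeriv .truncatedPendulum 0 3 3 g.1 g.2 +
        (86 / 39 : ℝ) • monoDeriv .truncatedPendulum 0 3 5 g.1 g.2 +
        (-9853 / 6006 : ℝ) • monoDeriv .truncatedPendulum 0 5 3 g.1 g.2 +
        (41 / 39 : ℝ) • monoDeriv .truncatedPendulum 0 7 3 g.1 g.2) (by simp [hm]) fun s => ?_
    rw [← hE s]
    simp [cubP, cubQ, cubicWeight, monoDeriv, fieldPath, HamCase.ham, pathEval, HamCase.a,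
      HamCase.b]
    ring
  | eightLoop =>
    refine integral01_eq_of_sub
      (f := (48 / 1001 : ℝ) • monoDeriv .eightLoop 0 1 3 g.1 g.2 +
        (160 / 1001 : ℝ) • monoDeriv .eightLoop 0 1 5 g.1 g.2 +
        (-12 / 91 : ℝ) • monoDeriv .eightLoop 0 3 3 g.1 g.2 +
        (86 / 39 : ℝ) • monoDeriv .eightLoop 0 3 5 g.1 g.2 +
        (9853 / 6006 : ℝ) • monoDeriv .eightLoop 0 5 3 g.1 g.2 +
        (-41 / 39 : ℝ) • monoDeriv .eightLoop 0 7 3 g.1 g.2) (by simp [hm]) fun s => ?_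
    rw [← hE s]
    simp [cubP, cubQ, cubicWeight, monoDeriv, fieldPath, HamCase.ham, pathEval, HamCase.a,
      HamCase.b]
    ring

/-- The direction along which the perturbation is relatively exact:
`(y² - 3 a x² - 3 b x⁴) y dx = d(x y³) - 3 x y dH`. -/
def exactDir (c : HamCase) : Fin 6 → ℝ := ![0, -3 * c.a, 1, -3 * c.b, 0, 0]

/-- The primitive of second order along the relatively exact direction. -/
def secondPrimitive (c : HamCase) (z : ℝ × ℝ) : ℝ :=
  -3 / 2 * (z.1 ^ 2 * z.2 ^ 4) + 3 / 4 * c.a * (z.1 ^ 4 * z.2 ^ 2) + c.b / 2 * (z.1 ^ 6 * z.2 ^ 2) +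
    c.a ^ 2 / 4 * z.1 ^ 6 + 5 / 16 * (c.a * c.b) * z.1 ^ 8 + c.b ^ 2 / 10 * z.1 ^ 10

/-- The increment of `H` along a solution of `X_l`, `l = β + s • exactDir`, written in the form
`O(β) + s ΔF₁ + s² ΔF₂ + O(s³)`. -/
theorem IsSol.ham_sub_ham (h : IsSol c T z l g) {β : Fin 6 → ℝ} {s : ℝ}
    (hl : l = β + s • exactDir c) :
    c.ham (pathEval g 1) - c.ham z =
      T * integral01 (dampPath β g.1 g.2 * g.2 ^ 2 *
        (1 - (3 * s) • (g.1 * g.2) + s ^ 2 • cubicWeight c g.1 g.2)) +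
      s * ((pathEval g 1).1 * (pathEval g 1).2 ^ 3 - z.1 * z.2 ^ 3) +
      s ^ 2 * (secondPrimitive c (pathEval g 1) - secondPrimitive c z) +
      s ^ 3 * (T * integral01 (cubicWeight c g.1 g.2 * (monoDeriv c l 1 3 g.1 g.2 -
        (3 : ℝ) • (g.1 * g.2 * (dampPath l g.1 g.2 * g.2 ^ 2))))) := by
  have hm := h.integral_monoDeriv
  -- This is dH = f y dx, integrated in time with dx = y dt.
  have hH : c.ham (pathEval g 1) - c.ham z = T * integral01 (dampPath l g.1 g.2 * g.2 ^ 2) := by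
    have e : dampPath l g.1 g.2 * g.2 ^ 2 = (1 / 2 : ℝ) • monoDeriv c l 0 2 g.1 g.2 +
        (c.a / 2) • monoDeriv c l 2 0 g.1 g.2 + (c.b / 4) • monoDeriv c l 4 0 g.1 g.2 := by
      ext r
      simp [monoDeriv, fieldPath_eq]
      ring
    rw [e]
    simp only [map_add, map_smul, smul_eq_mul, HamCase.ham]
    linear_combination -(1 / 2) * hm 0 2 - c.a / 2 * hm 2 0 - c.b / 4 * hm 4 0
  have hQ : secondPrimitive c (pathEval g 1) - secondPrimitive c z =
      T * integral01 ((-3 / 2 : ℝ) • monoDeriv c l 2 4 g.1 g.2 +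
        (3 / 4 * c.a) • monoDeriv c l 4 2 g.1 g.2 + (c.b / 2) • monoDeriv c l 6 2 g.1 g.2 +
        (c.a ^ 2 / 4) • monoDeriv c l 6 0 g.1 g.2 +
        (5 / 16 * (c.a * c.b)) • monoDeriv c l 8 0 g.1 g.2 +
        (c.b ^ 2 / 10) • monoDeriv c l 10 0 g.1 g.2) := by
    simp only [map_add, map_smul, smul_eq_mul, secondPrimitive]
    linear_combination 3 / 2 * hm 2 4 - 3 / 4 * c.a * hm 4 2 - c.b / 2 * hm 6 2 -
      c.a ^ 2 / 4 * hm 6 0 - 5 / 16 * (c.a * c.b) * hm 8 0 - c.b ^ 2 / 10 * hm 10 0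
  have hU := hm 1 3
  rw [pow_one, pow_one] at hU
  rw [hH, ← hU, hQ]
  simp only [mul_left_comm _ T, ← mul_add]
  congr 1
  simp only [← smul_eq_mul, ← map_smul, ← map_add]
  congr 1
  -- What remains is pointwise: use ω = dF₁ + q dH with q = -3xy, and qω = dF₂ + (q² + q₂) dH, where
  -- q² + q₂ is `cubicWeight`.
  subst hl
  ext r
  simp [dampPath, monoDeriv, fieldPath, cubicWeight, exactDir]
  ring

end Solution

/-- The previous identity with no perturbation, applied to the orbit cut at time s. -/
theorem IsSol.ham_eq {c : HamCase} {T : ℝ} {z : ℝ × ℝ} {g : PlanePath}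
    (h : IsSol c T z 0 g) (s : unitInterval) : c.ham (pathEval g s) = c.ham z := by
  obtain ⟨g', hg', he⟩ := h.restrict s
  have := hg'.ham_sub_ham (β := 0) (s := 0) (by simp)
  have e : dampPath 0 g'.1 g'.2 = 0 := by simp [dampPath]
  rw [e] at this
  simp only [zero_mul, map_zero, mul_zero, ne_eq, OfNat.ofNat_ne_zero, not_false_eq_true, zero_pow,
    add_zero] at this
  rw [← he]
  linarith

/-! ### Return data attached to each oval -/

section Section

variable {A : PeriodAnnulus} {σ : ℝ → ℝ × ℝ}

/-- The return data near the oval of level `h₀`, for all nearby levels and parameters. -/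
theorem exists_return_data (hσ : A.IsCrossSection σ) {h₀ : ℝ} (hh : h₀ ∈ A.levels) :
    ∃ (τ κ : ℝ × (Fin 6 → ℝ) → ℝ)
      (Γ : ℝ × (Fin 6 → ℝ) → PlanePath),
      AnalyticAt ℝ τ (h₀, 0) ∧ AnalyticAt ℝ κ (h₀, 0) ∧ AnalyticAt ℝ Γ (h₀, 0) ∧
      κ (h₀, 0) = h₀ ∧
      ∀ᶠ p in 𝓝 (h₀, (0 : Fin 6 → ℝ)),
        p.1 ∈ A.levels ∧ κ p ∈ A.levels ∧ 0 < τ p ∧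
        IsSol A.hamCase (τ p) (σ p.1) p.2 (Γ p) ∧ pathEval (Γ p) 1 = σ (κ p) ∧
        ∀ s : unitInterval, 0 < s → s < 1 → pathEval (Γ p) s ∉ σ '' A.levels := by
  obtain ⟨γ, T, hγ⟩ := exists_isOvalParam A hh
  obtain ⟨δ, hδ, h0, hT, hne, hmem, -⟩ := hγ.rebase (hσ.2 h₀ hh)
  have hc : Continuous δ := continuous_iff_continuousAt.2 fun t => (hδ t).continuousAt
  obtain ⟨τ, κ, Γ, h1, h2, h3, -, h5, -, h7⟩ := exists_first_return hσ hh hc hδ h0 hγ.1 hT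
    fun t ht => not_mem_section_of_ne hσ (hmem t) (hne t ht)
  exact ⟨τ, κ, Γ, h1, h2, h3, h5, h7⟩

/-- A closed solution that first returns at the end computes the oval integrals. -/
theorem ovalIntegral_eq_of_isSol (hσ : A.IsCrossSection σ) {h τ : ℝ} (hh : h ∈ A.levels)
    {g : PlanePath} (hτ : 0 < τ) (hg : IsSol A.hamCase τ (σ h) 0 g)
    (h1 : pathEval g 1 ∈ σ '' A.levels)
    (hn : ∀ s : unitInterval, 0 < s → s < 1 → pathEval g s ∉ σ '' A.levels) {γ : ℝ → ℝ × ℝ} {T : ℝ}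
    (hγ : A.IsOvalParam h γ T) (k : ℕ) :
    ovalIntegral k γ T = τ * integral01 (g.1 ^ k * g.2 ^ 2) := by
  obtain ⟨δ, hδ, h0, hT, hne, hmem, hint⟩ := hγ.rebase (hσ.2 h hh)
  have hc : Continuous δ := continuous_iff_continuousAt.2 fun t => (hδ t).continuousAt
  obtain ⟨τ', hτ', γ', hd', h0', hT', hS', hn'⟩ := hg.isFirstReturn hτ rfl h1 hn
  have key : ∀ s : unitInterval, toUnit (τ * s / τ) = s := fun s => by
    rw [mul_div_cancel_left₀ _ hτ.ne', toUnit_coe]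
  obtain ⟨rfl, he⟩ := first_return_unique (S := σ '' A.levels) hγ.1 hτ
    (fun t _ => (hδ t).hasDerivWithinAt) (fun t ht => hg.hasDerivWithinAt_div hτ ht)
    (by
      simp only [zero_div]
      rw [show toUnit 0 = 0 from projIcc_left _, hg.start, h0])
    (by rw [hT]; exact ⟨h, hh, rfl⟩)
    (by
      have := key 1
      simp only [Set.Icc.coe_one, mul_one] at this
      simp only [this]
      exact h1)
    (fun t ht => not_mem_section_of_ne hσ (hmem t) (hne t ht))
    (fun t ht => by
      have h2 : t / τ ∈ Ioo (0 : ℝ) 1 := ⟨div_pos ht.1 hτ, (div_lt_one hτ).2 ht.2⟩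
      have e : toUnit (t / τ) = ⟨t / τ, Ioo_subset_Icc_self h2⟩ :=
        projIcc_of_mem _ (Ioo_subset_Icc_self h2)
      refine hn _ ?_ ?_ <;> rw [e]
      · exact h2.1
      · exact h2.2)
  have hs : samplePath δ hc T = g := by
    have hp : ∀ s : unitInterval, pathEval (samplePath δ hc T) s = pathEval g s := fun s => by
      rw [pathEval_samplePath, he ⟨by have := s.2.1; positivity, mul_le_of_le_one_right hτ.le s.2.2⟩]
      simp only [key s]
    exact Prod.ext (ContinuousMap.ext fun s => congrArg Prod.fst (hp s))
      (ContinuousMap.ext fun s => congrArg Prod.snd (hp s))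
  rw [← hint, ovalIntegral_eq hc hδ, hs]

end Section

/-! ### Gelfand–Leray derivatives, Picard–Fuchs system, independence of I_2 and I_0 -/

/-- The derivative with respect to the level of the integrals of `x ^ k y dx` along an analytic
family of closed orbits (Gelfand–Leray). -/
theorem hasDerivAt_loop_integral {c : HamCase} {h₀ : ℝ} {τ : ℝ → ℝ}
    {x y : ℝ → C(unitInterval, ℝ)} (hτ : DifferentiableAt ℝ τ h₀) (hx : DifferentiableAt ℝ x h₀)
    (hy : DifferentiableAt ℝ y h₀)
    (hsol : ∀ᶠ h in 𝓝 h₀, IsSol c (τ h) (pathEval (x h, y h) 0) 0 (x h, y h))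
    (hcl : ∀ᶠ h in 𝓝 h₀, pathEval (x h, y h) 1 = pathEval (x h, y h) 0)
    (hH : ∀ᶠ h in 𝓝 h₀, ∀ s, c.ham (pathEval (x h, y h) s) = h) (k : ℕ) :
    HasDerivAt (fun h => τ h * integral01 (x h ^ k * y h ^ 2))
      (τ h₀ * integral01 (x h₀ ^ k)) h₀ := by
  set τ' := deriv τ h₀
  set x' := deriv x h₀
  set y' := deriv y h₀
  have dτ : HasDerivAt τ τ' h₀ := hτ.hasDerivAt
  have dx : HasDerivAt x x' h₀ := hx.hasDerivAt
  have dy : HasDerivAt y y' h₀ := hy.hasDerivAt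
  have ev : ∀ {u : ℝ → C(unitInterval, ℝ)} {u' : C(unitInterval, ℝ)} (s : unitInterval),
      HasDerivAt u u' h₀ → HasDerivAt (fun h => u h s) (u' s) h₀ := fun s hu =>
    ((ContinuousMap.evalCLM ℝ s : C(unitInterval, ℝ) →L[ℝ] ℝ).hasFDerivAt (x := _)).comp_hasDerivAt
      h₀ hu
  -- Differentiate the integral equation for x in the level: primes denote derivatives in h.
  have f1 : PathDeriv x' (τ' • y h₀ + τ h₀ • y') := by
    have e1 : HasDerivAt (fun h => x h 0 • (1 : C(unitInterval, ℝ)) + τ h • primitive (y h))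
        (x' 0 • 1 + (τ h₀ • primitive y' + τ' • primitive (y h₀))) h₀ :=
      ((ev 0 dx).smul_const _).fun_add
        (dτ.fun_smul (primitive.hasFDerivAt.comp_hasDerivAt h₀ dy))
    have e2 := dx.unique (e1.congr_of_eventuallyEq (by
      filter_upwards [hsol] with h hs
      have := hs.deriv_fst.eq_primitive
      rw [map_smul] at this
      exact this))
    refine pathDeriv_iff.2 ?_
    rw [map_add, map_smul, map_smul, add_comm (τ' • _)]
    exact e2
  have f2 : ∀ s, y h₀ s * y' s + (c.a * x h₀ s + c.b * x h₀ s ^ 3) * x' s = 1 := fun s => by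
    have e1 : HasDerivAt (fun h => c.ham (pathEval (x h, y h) s)) _ h₀ :=
      (hasFDerivAt_ham c _).comp_hasDerivAt h₀ ((ev s dx).prodMk (ev s dy))
    have e2 := (e1.congr_of_eventuallyEq
      (show (fun h => h) =ᶠ[𝓝 h₀] _ from hH.mono fun h hs => (hs s).symm)).unique (hasDerivAt_id h₀)
    simp [pathEval] at e2
    linear_combination e2
  have f3 : x' 1 = x' 0 := by
    refine ((ev 1 dx).congr_of_eventuallyEq ?_).unique (ev 0 dx)
    filter_upwards [hcl] with h hs
    exact (congrArg Prod.fst hs).symm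
  have s0 := hsol.self_of_nhds
  have c0 := hcl.self_of_nhds
  -- The derivative of the integral differs from τ ∫ x^k by the integral of d(x^k y x')/ds, by
  -- virtue of `f2`; this vanishes on a closed orbit.
  have f4 := (((s0.deriv_fst.pow k).mul s0.deriv_snd).mul f1).integral01_eq
  simp only [ContinuousMap.mul_apply, ContinuousMap.pow_apply] at f4
  have cx : x h₀ 1 = x h₀ 0 := congrArg Prod.fst c0
  have cy : y h₀ 1 = y h₀ 0 := congrArg Prod.snd c0
  rw [cx, cy, f3, sub_self] at f4
  have dI : HasDerivAt (fun h => τ h * integral01 (x h ^ k * y h ^ 2)) _ h₀ :=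
    dτ.fun_mul (integral01.hasFDerivAt.comp_hasDerivAt h₀ ((dx.fun_pow k).fun_mul (dy.fun_pow 2)))
  refine dI.congr_deriv ?_
  refine (eq_add_of_sub_eq' (?_ : _ - _ = τ h₀ * integral01 (x h₀ ^ k))).trans
    ((congrArg (· + _) f4).trans (zero_add _))
  simp only [← smul_eq_mul, ← map_smul, ← map_add, ← map_sub]
  congr 1
  ext s
  have f2s := f2 s
  simp [fieldPath]
  have e2 : (2 : C(unitInterval, ℝ)) s = 2 := rfl
  rw [e2]
  linear_combination (τ h₀ * x h₀ s ^ k) * f2s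

theorem HamCase.a_sq (c : HamCase) : c.a ^ 2 = 1 := by cases c <;> norm_num [HamCase.a]

theorem HamCase.b_sq (c : HamCase) : c.b ^ 2 = 1 := by cases c <;> norm_num [HamCase.b]

/-- Picard–Fuchs relations between the integrals of `x ^ k y dx` and of `x ^ k dt`. -/
theorem IsSol.picard_fuchs {c : HamCase} {T : ℝ} {z : ℝ × ℝ}
    {g : PlanePath} (h : IsSol c T z 0 g) (hT : T ≠ 0)
    (hz : pathEval g 1 = z) {E : ℝ} (hE : ∀ s, c.ham (pathEval g s) = E) :
    4 * E * integral01 (g.1 ^ 0) =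
        3 * integral01 (g.1 ^ 0 * g.2 ^ 2) + c.a * integral01 (g.1 ^ 2) ∧
      (4 * E + c.b) * integral01 (g.1 ^ 2) =
        5 * integral01 (g.1 ^ 2 * g.2 ^ 2) + c.a * c.b * integral01 (g.1 ^ 0 * g.2 ^ 2) := by
  have hm := h.integral_monoDeriv_closed hT hz
  -- The first relation comes from d(xy), the second from d(x³y) + ab d(xy).
  have h1 := hm 1 1
  have h2 := hm 3 1
  have ha := c.a_sq
  have hb := c.b_sq
  constructor
  · rw [← sub_zero (3 * _ + _), ← h1]
    simp only [← smul_eq_mul, ← map_smul, ← map_add, ← map_sub]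
    congr 1
    ext s
    rw [← hE s]
    simp [monoDeriv, fieldPath, HamCase.ham, pathEval]
    ring
  · have h3 : integral01 (monoDeriv c 0 3 1 g.1 g.2 + (c.a * c.b) • monoDeriv c 0 1 1 g.1 g.2) = 0 := by
      rw [map_add, map_smul, h1, h2]
      simp
    rw [← sub_zero (5 * _ + _), ← h3]
    simp only [← smul_eq_mul, ← map_smul, ← map_add, ← map_sub]
    congr 1
    ext s
    rw [← hE s]
    simp [monoDeriv, fieldPath, HamCase.ham, pathEval]
    linear_combination (-c.b * g.1 s ^ 2) * ha - c.a * g.1 s ^ 4 * hb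

/-- If y vanished identically, x would be constant and the orbit an equilibrium. -/
theorem IsSol.integral_sq_pos {c : HamCase} {T : ℝ} {z : ℝ × ℝ} {l : Fin 6 → ℝ}
    {g : PlanePath} (h : IsSol c T z l g) (hT : T ≠ 0)
    (hf : c.field l z ≠ 0) : 0 < integral01 (g.1 ^ 0 * g.2 ^ 2) := by
  have hex : ∃ s, g.2 s ≠ 0 := by
    by_contra! hy
    have hd1 := h.hasDerivWithinAt (t := 0) (left_mem_Icc.2 zero_le_one)
    have e0 : toUnit 0 = 0 := projIcc_left _
    rw [e0, h.start] at hd1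
    have hx : ∀ s, g.1 s = g.1 0 := fun s => by
      have e1 : g.2 = 0 := ContinuousMap.ext hy
      have := congrArg (fun f : C(unitInterval, ℝ) => f s) h.deriv_fst.eq_primitive
      simpa [e1] using this
    have hconst : (fun t => pathEval g (toUnit t)) = fun _ => z := by
      ext1 t
      rw [← h.start]
      simp [pathEval, hx (toUnit t), hy]
    rw [hconst] at hd1
    have := (uniqueDiffOn_Icc_zero_one 0 (left_mem_Icc.2 zero_le_one)).eq_deriv _ hd1
      (hasDerivWithinAt_const _ _ _)
    exact hf ((smul_eq_zero.1 this).resolve_left hT)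
  obtain ⟨s, hs⟩ := hex
  rw [integral01_apply]
  refine intervalIntegral.integral_pos zero_lt_one (continuous_comp_toUnit _).continuousOn
    (fun t _ => ?_) ⟨s, s.2, ?_⟩
  · simp only [pow_zero, one_mul, ContinuousMap.pow_apply]
    positivity
  · rw [toUnit_coe]
    simp only [pow_zero, one_mul, ContinuousMap.pow_apply]
    positivity

/-- The Riccati equation of the ratio `I_2 / I_0` has no solution `-Q / P` with polynomials of
degree at most two. -/
theorem riccati_no_solution {a b p0 p1 p2 q0 q1 q2 : ℝ} (ha : a = 1 ∨ a = -1) (hb : b = 1 ∨ b = -1)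
    (c0 : 4 * b * p0 * q0 - 5 * a * q0 ^ 2 = 0)
    (c1 : 4 * b * (p0 * q1 - p1 * q0) + 4 * a * b * p0 ^ 2 + 4 * b * (p0 * q1 + p1 * q0) -
      8 * p0 * q0 - 10 * a * q0 * q1 = 0)
    (c2 : 16 * (p0 * q1 - p1 * q0) + 8 * b * (p0 * q2 - p2 * q0) + 8 * a * b * p0 * p1 +
      4 * b * (p0 * q2 + p1 * q1 + p2 * q0) - 8 * (p0 * q1 + p1 * q0) -
      5 * a * (2 * q0 * q2 + q1 ^ 2) = 0)
    (c3 : 32 * (p0 * q2 - p2 * q0) + 4 * b * (p1 * q2 - p2 * q1) +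
      4 * a * b * (2 * p0 * p2 + p1 ^ 2) + 4 * b * (p1 * q2 + p2 * q1) -
      8 * (p0 * q2 + p1 * q1 + p2 * q0) - 10 * a * q1 * q2 = 0)
    (c4 : 16 * (p1 * q2 - p2 * q1) + 8 * a * b * p1 * p2 + 4 * b * p2 * q2 -
      8 * (p1 * q2 + p2 * q1) - 5 * a * q2 ^ 2 = 0)
    (c5 : 4 * a * b * p2 ^ 2 - 8 * p2 * q2 = 0) :
    p0 = 0 ∧ p1 = 0 ∧ p2 = 0 ∧ q0 = 0 ∧ q1 = 0 ∧ q2 = 0 := by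
  have ha2 : a ^ 2 = 1 := by rcases ha with rfl | rfl <;> norm_num
  have hb2 : b ^ 2 = 1 := by rcases hb with rfl | rfl <;> norm_num
  -- Solve from the top degree down: c5, c4 and c3 express the leading unknowns in terms of the
  -- others, c0 splits into two branches, and the remaining equations leave no nonzero solution.
  by_cases hp2 : p2 = 0
  · subst hp2
    by_cases hq2 : q2 = 0
    · subst hq2
      clear ha hb
      grind
    · exfalso
      have h1 : q2 * (8 * p1 - 5 * a * q2) = 0 := by linear_combination c4
      have h1' : p1 = 5 / 8 * a * q2 := by
        linear_combination (1 / 8) * (mul_eq_zero.1 h1).resolve_left hq2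
      have h2 : q2 * (24 * p0 + (105 / 16) * a * b * q2 - 15 * a * q1) = 0 := by
        subst h1'
        rcases ha with rfl | rfl <;> rcases hb with rfl | rfl <;> linear_combination c3
      have h2' : p0 = 5 / 8 * a * q1 - (35 / 128) * a * b * q2 := by
        linear_combination (1 / 24) * (mul_eq_zero.1 h2).resolve_left hq2
      rcases mul_eq_zero.1 (show q0 * (4 * b * p0 - 5 * a * q0) = 0 by linear_combination c0)
        with h3 | h3
      · subst h3 h1' h2'
        rcases ha with rfl | rfl <;> rcases hb with rfl | rfl <;> grind
      · have h3' : q0 = 4 / 5 * a * b * p0 := by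
          rcases ha with rfl | rfl <;> linarith
        subst h3' h1' h2'
        rcases ha with rfl | rfl <;> rcases hb with rfl | rfl <;> grind
  · exfalso
    have h1 : q2 = a * b / 2 * p2 := by
      have : p2 * (4 * a * b * p2 - 8 * q2) = 0 := by linear_combination c5
      linear_combination (-1 / 8) * (mul_eq_zero.1 this).resolve_left hp2
    have h2 : q1 = a * b / 2 * p1 + a / 32 * p2 := by
      have : p2 * (12 * a * b * p1 + 3 / 4 * a * p2 - 24 * q1) = 0 := by
        subst h1
        rcases ha with rfl | rfl <;> rcases hb with rfl | rfl <;> linear_combination c4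
      linear_combination (-1 / 24) * (mul_eq_zero.1 this).resolve_left hp2
    have h3 : q0 = a * b / 2 * p0 + a / 32 * p1 - a * b / 256 * p2 := by
      have : p2 * (a * b / 2 * p0 + a / 32 * p1 - a * b / 256 * p2 - q0) = 0 := by
        subst h1 h2
        rcases ha with rfl | rfl <;> rcases hb with rfl | rfl <;> linear_combination (1 / 40) * c3
      linear_combination -(mul_eq_zero.1 this).resolve_left hp2
    rcases mul_eq_zero.1 (show q0 * (4 * b * p0 - 5 * a * q0) = 0 by linear_combination c0)
      with h4 | h4
    · have h5 : p0 = b / 128 * p2 * b - b / 16 * p1 := by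
        rcases ha with rfl | rfl <;> rcases hb with rfl | rfl <;> linarith
      clear c0 c3 c4 c5
      subst h1 h2 h3 h5
      rcases ha with rfl | rfl <;> rcases hb with rfl | rfl <;> grind
    · clear c0 c3 c4 c5
      have h5 : p1 = 48 / 5 * b * p0 + b / 8 * p2 := by
        rcases ha with rfl | rfl <;> rcases hb with rfl | rfl <;> linarith
      subst h1 h2 h3 h5
      rcases ha with rfl | rfl <;> rcases hb with rfl | rfl <;> grind

theorem coeff_eq_zero_of_infinite {c0 c1 c2 c3 c4 c5 : ℝ} {S : Set ℝ} (hS : S.Infinite)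
    (h : ∀ t ∈ S, c0 + c1 * t + c2 * t ^ 2 + c3 * t ^ 3 + c4 * t ^ 4 + c5 * t ^ 5 = 0) :
    c0 = 0 ∧ c1 = 0 ∧ c2 = 0 ∧ c3 = 0 ∧ c4 = 0 ∧ c5 = 0 := by
  have hp : (C c0 + C c1 * X + C c2 * X ^ 2 + C c3 * X ^ 3 + C c4 * X ^ 4 + C c5 * X ^ 5 : ℝ[X]) =
      0 := by
    refine Polynomial.eq_zero_of_infinite_isRoot _ (hS.mono fun t ht => ?_)
    simpa using h t ht
  refine ⟨?_, ?_, ?_, ?_, ?_, ?_⟩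
  · simpa [coeff_X, coeff_C] using congrArg (fun p => p.coeff 0) hp
  · simpa [coeff_X, coeff_C, coeff_X_pow] using congrArg (fun p => p.coeff 1) hp
  · simpa [coeff_X, coeff_C, coeff_X_pow] using congrArg (fun p => p.coeff 2) hp
  · simpa [coeff_X, coeff_C, coeff_X_pow] using congrArg (fun p => p.coeff 3) hp
  · simpa [coeff_X, coeff_C, coeff_X_pow] using congrArg (fun p => p.coeff 4) hp
  · simpa [coeff_X, coeff_C, coeff_X_pow] using congrArg (fun p => p.coeff 5) hp

section Section

variable {A : PeriodAnnulus} {σ : ℝ → ℝ × ℝ}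

/-- The integrals `I_0` and `I_2` and their derivatives, as functions of the level. -/
theorem exists_derivs_ovalIntegral (hσ : A.IsCrossSection σ) {i0 i2 : ℝ → ℝ}
    (h0 : ∀ h ∈ A.levels, ∀ γ T, A.IsOvalParam h γ T → ovalIntegral 0 γ T = i0 h)
    (h2 : ∀ h ∈ A.levels, ∀ γ T, A.IsOvalParam h γ T → ovalIntegral 2 γ T = i2 h) {h : ℝ}
    (hh : h ∈ A.levels) :
    ∃ j0 j2, HasDerivAt i0 j0 h ∧ HasDerivAt i2 j2 h ∧
      4 * h * j0 = 3 * i0 h + A.hamCase.a * j2 ∧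
      (4 * h + A.hamCase.b) * j2 = 5 * i2 h + A.hamCase.a * A.hamCase.b * i0 h ∧ 0 < i0 h := by
  obtain ⟨τ, κ, Γ, hτ, -, hΓ, -, hev⟩ := exists_return_data hσ hh
  have hι : AnalyticAt ℝ (fun t : ℝ => (t, (0 : Fin 6 → ℝ))) h := analyticAt_id.prod analyticAt_const
  have hτ' : AnalyticAt ℝ (fun t => τ (t, 0)) h := AnalyticAt.fun_comp (g := τ) hτ hι
  have hΓ' : AnalyticAt ℝ (fun t => Γ (t, 0)) h := AnalyticAt.fun_comp (g := Γ) hΓ hι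
  have hev' := hι.continuousAt.eventually hev
  have key : ∀ᶠ t in 𝓝 h, t ∈ A.levels ∧ 0 < τ (t, 0) ∧
      IsSol A.hamCase (τ (t, 0)) (σ t) 0 (Γ (t, 0)) ∧ pathEval (Γ (t, 0)) 1 = σ t ∧
      (∀ s, A.hamCase.ham (pathEval (Γ (t, 0)) s) = t) ∧
      i0 t = τ (t, 0) * integral01 ((Γ (t, 0)).1 ^ 0 * (Γ (t, 0)).2 ^ 2) ∧
      i2 t = τ (t, 0) * integral01 ((Γ (t, 0)).1 ^ 2 * (Γ (t, 0)).2 ^ 2) := by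
    filter_upwards [hev'] with t ht
    obtain ⟨h1, h2', h3, h4, h5, h6⟩ := ht
    have hE : ∀ s, A.hamCase.ham (pathEval (Γ (t, 0)) s) = t := fun s => by
      rw [h4.ham_eq s, hσ.ham_eq h1]
    have hκ : κ (t, 0) = t := by rw [← hσ.ham_eq h2', ← h5, hE]
    rw [hκ] at h5
    obtain ⟨γ, T, hγ⟩ := exists_isOvalParam A h1
    have hS : pathEval (Γ (t, 0)) 1 ∈ σ '' A.levels := h5 ▸ ⟨t, h1, rfl⟩
    refine ⟨h1, h3, h4, h5, hE, ?_, ?_⟩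
    · rw [← h0 t h1 γ T hγ, ovalIntegral_eq_of_isSol hσ h1 h3 h4 hS h6 hγ]
    · rw [← h2 t h1 γ T hγ, ovalIntegral_eq_of_isSol hσ h1 h3 h4 hS h6 hγ]
  have hd := fun k => hasDerivAt_loop_integral (c := A.hamCase) (x := fun t => (Γ (t, 0)).1)
    (y := fun t => (Γ (t, 0)).2) hτ'.differentiableAt hΓ'.differentiableAt.fst
    hΓ'.differentiableAt.snd (key.mono fun t ht => by
      have : pathEval ((Γ (t, 0)).1, (Γ (t, 0)).2) 0 = σ t := ht.2.2.1.start
      rw [this]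
      exact ht.2.2.1)
    (key.mono fun t ht => ht.2.2.2.1.trans ht.2.2.1.start.symm) (key.mono fun t ht => ht.2.2.2.2.1) k
  obtain ⟨-, h1, h3, h4, h5, h6, h7⟩ := key.self_of_nhds
  obtain ⟨pf0, pf2⟩ := h3.picard_fuchs h1.ne' h4 h5
  refine ⟨_, _, (hd 0).congr_of_eventuallyEq (key.mono fun t ht => ht.2.2.2.2.2.1),
    (hd 2).congr_of_eventuallyEq (key.mono fun t ht => ht.2.2.2.2.2.2), ?_, ?_, ?_⟩
  · rw [h6]
    linear_combination τ (h, 0) * pf0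
  · rw [h6, h7]
    linear_combination τ (h, 0) * pf2
  · rw [h6]
    exact mul_pos h1 (h3.integral_sq_pos h1.ne' (field_ne_zero_of_mem_oval hh (hσ.2 h hh)))

/-- `I_2` and `I_0` are linearly independent over the polynomials of degree at most two. -/
theorem coeffs_eq_zero_of_integral_relation (hσ : A.IsCrossSection σ) {p0 p1 p2 q0 q1 q2 : ℝ}
    (hrel : ∀ h ∈ A.levels, ∀ γ T, A.IsOvalParam h γ T →
      (p0 + p1 * h + p2 * h ^ 2) * ovalIntegral 2 γ T +
        (q0 + q1 * h + q2 * h ^ 2) * ovalIntegral 0 γ T = 0) :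
    p0 = 0 ∧ p1 = 0 ∧ p2 = 0 ∧ q0 = 0 ∧ q1 = 0 ∧ q2 = 0 := by
  -- All parametrizations of an oval give the same integral, since it can be computed from the
  -- return data; hence it is a function of the level.
  have hex : ∀ k, ∃ i : ℝ → ℝ, ∀ h ∈ A.levels, ∀ γ T, A.IsOvalParam h γ T →
      ovalIntegral k γ T = i h := by
    intro k
    have : ∀ h : ℝ, ∃ v : ℝ, h ∈ A.levels → ∀ γ T, A.IsOvalParam h γ T → ovalIntegral k γ T = v := by
      intro h
      by_cases hh : h ∈ A.levels
      · obtain ⟨τ, κ, Γ, -, -, -, -, hev⟩ := exists_return_data hσ hh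
        obtain ⟨-, hκ, h3, h4, h5, h6⟩ := hev.self_of_nhds
        exact ⟨_, fun _ γ T hγ =>
          ovalIntegral_eq_of_isSol hσ hh h3 h4 (h5 ▸ ⟨_, hκ, rfl⟩) h6 hγ k⟩
      · exact ⟨0, fun h' => absurd h' hh⟩
    choose i hi using this
    exact ⟨i, fun h hh => hi h hh⟩
  obtain ⟨i0, hi0⟩ := hex 0
  obtain ⟨i2, hi2⟩ := hex 2
  set a := A.hamCase.a with ha
  set b := A.hamCase.b with hb
  have hab : (a = 1 ∨ a = -1) ∧ (b = 1 ∨ b = -1) :=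
    ⟨sq_eq_one_iff.1 A.hamCase.a_sq,
      sq_eq_one_iff.1 A.hamCase.b_sq⟩
  have hzero : ∀ h ∈ A.levels, (p0 + p1 * h + p2 * h ^ 2) * i2 h +
      (q0 + q1 * h + q2 * h ^ 2) * i0 h = 0 := fun h hh => by
    obtain ⟨γ, T, hγ⟩ := exists_isOvalParam A hh
    rw [← hi0 h hh γ T hγ, ← hi2 h hh γ T hγ]
    exact hrel h hh γ T hγ
  have hinf : A.levels.Infinite := by
    obtain ⟨h, hh⟩ := A.levels_nonempty
    exact infinite_of_mem_nhds h (A.isOpen_levels.mem_nhds hh)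
  obtain ⟨e0, e1, e2, e3, e4, e5⟩ := coeff_eq_zero_of_infinite
    (c0 := 4 * b * p0 * q0 - 5 * a * q0 ^ 2)
    (c1 := 4 * b * (p0 * q1 - p1 * q0) + 4 * a * b * p0 ^ 2 + 4 * b * (p0 * q1 + p1 * q0) -
      8 * p0 * q0 - 10 * a * q0 * q1)
    (c2 := 16 * (p0 * q1 - p1 * q0) + 8 * b * (p0 * q2 - p2 * q0) + 8 * a * b * p0 * p1 +
      4 * b * (p0 * q2 + p1 * q1 + p2 * q0) - 8 * (p0 * q1 + p1 * q0) -
      5 * a * (2 * q0 * q2 + q1 ^ 2))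
    (c3 := 32 * (p0 * q2 - p2 * q0) + 4 * b * (p1 * q2 - p2 * q1) +
      4 * a * b * (2 * p0 * p2 + p1 ^ 2) + 4 * b * (p1 * q2 + p2 * q1) -
      8 * (p0 * q2 + p1 * q1 + p2 * q0) - 10 * a * q1 * q2)
    (c4 := 16 * (p1 * q2 - p2 * q1) + 8 * a * b * p1 * p2 + 4 * b * p2 * q2 -
      8 * (p1 * q2 + p2 * q1) - 5 * a * q2 ^ 2)
    (c5 := 4 * a * b * p2 ^ 2 - 8 * p2 * q2) hinf (fun h hh => by
      obtain ⟨j0, j2, d0, d2, r0, r2, hpos⟩ := exists_derivs_ovalIntegral hσ hi0 hi2 hh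
      have dp : ∀ u v w : ℝ, HasDerivAt (fun t : ℝ => u + v * t + w * t ^ 2) (v + w * (2 * h)) h := by
        intro u v w
        have := (((hasDerivAt_id h).const_mul v).const_add u).fun_add
          (((hasDerivAt_id h).fun_pow 2).const_mul w)
        simpa using this
      have hd := ((dp p0 p1 p2).fun_mul d2).fun_add ((dp q0 q1 q2).fun_mul d0)
      have hd0 := (hd.congr_of_eventuallyEq (show (fun _ => (0 : ℝ)) =ᶠ[𝓝 h] _ by
        filter_upwards [A.isOpen_levels.mem_nhds hh] with t ht
        exact (hzero t ht).symm)).unique (hasDerivAt_const h 0)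
      have hz := hzero h hh
      have ha2 : a ^ 2 = 1 := A.hamCase.a_sq
      refine (mul_eq_zero.1 (?_ : _ * i0 h = 0)).resolve_right hpos.ne'
      set P := p0 + p1 * h + p2 * h ^ 2 with hP
      set Q := q0 + q1 * h + q2 * h ^ 2 with hQ
      -- The derivative of P I_2 + Q I_0 = 0, cleared of I_0' and I_2' by the Picard–Fuchs
      -- relations. Multiplying it by P and using P I_2 = -Q I_0 then leaves a polynomial of degree
      -- at most 5 times I_0 > 0.
      have hmul : 4 * h * (4 * h + b) * (p1 + p2 * (2 * h)) * i2 h + 4 * h * P * (5 * i2 h + a * b * i0 h) +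
          4 * h * (4 * h + b) * (q1 + q2 * (2 * h)) * i0 h +
          Q * (3 * (4 * h + b) * i0 h + a * (5 * i2 h + a * b * i0 h)) = 0 := by
        linear_combination (4 * h * (4 * h + b)) * hd0 - (4 * h * P + Q * a) * r2 -
          (Q * (4 * h + b)) * r0
      have hfin : (P * (4 * h * (4 * h + b) * (q1 + q2 * (2 * h)) + 4 * a * b * h * P +
          (12 * h + 3 * b + a ^ 2 * b) * Q) -
          Q * (4 * h * (4 * h + b) * (p1 + p2 * (2 * h)) + 20 * h * P + 5 * a * Q)) * i0 h = 0 := by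
        linear_combination P * hmul - (4 * h * (4 * h + b) * (p1 + p2 * (2 * h)) + 20 * h * P +
          5 * a * Q) * hz
      rw [ha2] at hfin
      rw [hP, hQ] at hfin
      linear_combination hfin)
  exact riccati_no_solution hab.1 hab.2 e0 e1 e2 e3 e4 e5

end Section

/-! ### Deformations along an arc and the induction on the order -/

section Arc

variable {A : PeriodAnnulus} {σ : ℝ → ℝ × ℝ} {lam : ℝ → Fin 6 → ℝ}

/-- The return data of a deformation through a fixed point of the cross section. -/
theorem exists_return_arc (hσ : A.IsCrossSection σ) (hlam : AnalyticAt ℝ lam 0) (hlam0 : lam 0 = 0)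
    {h : ℝ} (hh : h ∈ A.levels) :
    ∃ (τ κ : ℝ → ℝ) (Γ : ℝ → PlanePath),
      AnalyticAt ℝ τ 0 ∧ AnalyticAt ℝ κ 0 ∧ AnalyticAt ℝ Γ 0 ∧ κ 0 = h ∧
      ∀ᶠ ε in 𝓝 (0 : ℝ),
        κ ε ∈ A.levels ∧ 0 < τ ε ∧ IsSol A.hamCase (τ ε) (σ h) (lam ε) (Γ ε) ∧
        pathEval (Γ ε) 1 = σ (κ ε) ∧
        ∀ s : unitInterval, 0 < s → s < 1 → pathEval (Γ ε) s ∉ σ '' A.levels := by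
  obtain ⟨τ, κ, Γ, hτ, hκ, hΓ, h0, hev⟩ := exists_return_data hσ hh
  have hι : AnalyticAt ℝ (fun ε => (h, lam ε)) 0 := analyticAt_const.prod hlam
  have e0 : (h, lam 0) = (h, (0 : Fin 6 → ℝ)) := by rw [hlam0]
  rw [← e0] at hτ hκ hΓ hev
  refine ⟨fun ε => τ (h, lam ε), fun ε => κ (h, lam ε), fun ε => Γ (h, lam ε),
    AnalyticAt.fun_comp (g := τ) hτ hι, AnalyticAt.fun_comp (g := κ) hκ hι,
    AnalyticAt.fun_comp (g := Γ) hΓ hι, by simp only [hlam0, h0], ?_⟩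
  exact (hι.continuousAt.eventually hev).mono fun ε hε => hε.2

theorem isDisplacement_of_isSol {l : Fin 6 → ℝ} {h k τ : ℝ}
    {g : PlanePath} (hk : k ∈ A.levels) (hτ : 0 < τ)
    (hg : IsSol A.hamCase τ (σ h) l g) (h1 : pathEval g 1 = σ k)
    (hn : ∀ s : unitInterval, 0 < s → s < 1 → pathEval g s ∉ σ '' A.levels) :
    IsDisplacement A σ l h (k - h) :=
  ⟨k, hk, hg.isFirstReturn hτ h1 ⟨k, hk, rfl⟩ hn, rfl⟩

/-- The displacement function of a deformation is well defined, analytic, and vanishes at `0`. -/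
theorem displacement_arc (hσ : A.IsCrossSection σ) (hlam : AnalyticAt ℝ lam 0) (hlam0 : lam 0 = 0)
    {h : ℝ} (hh : h ∈ A.levels) :
    (∀ᶠ ε in 𝓝 (0 : ℝ), ∃! δ, IsDisplacement A σ (lam ε) h δ) ∧
      AnalyticAt ℝ (fun ε => displacement A σ (lam ε) h) 0 ∧
      displacement A σ (lam 0) h = 0 := by
  obtain ⟨τ, κ, Γ, -, hκ, -, h0, hev⟩ := exists_return_arc hσ hlam hlam0 hh
  have hd : ∀ᶠ ε in 𝓝 (0 : ℝ), IsDisplacement A σ (lam ε) h (κ ε - h) :=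
    hev.mono fun ε ⟨h1, h2, h3, h4, h5⟩ => isDisplacement_of_isSol h1 h2 h3 h4 h5
  refine ⟨hd.mono fun ε h1 => ⟨_, h1, fun δ h2 => isDisplacement_unique hσ h2 h1⟩, ?_, ?_⟩
  · exact (hκ.fun_sub analyticAt_const).congr (hd.mono fun ε h1 => (displacement_eq hσ h1).symm)
  · rw [displacement_eq hσ hd.self_of_nhds, h0, sub_self]

theorem dampPath_smul (r : ℝ) (l : Fin 6 → ℝ) (x y : C(unitInterval, ℝ)) :
    dampPath (r • l) x y = r • dampPath l x y := by
  simp [dampPath, mul_smul]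

theorem dampPath_zero (x y : C(unitInterval, ℝ)) : dampPath 0 x y = 0 := by simp [dampPath]

/-- The coefficient of order `n` of the displacement function of a deformation that agrees to order
`n` with one in the relatively exact direction, the latter being of order at least `n / 3`. -/
theorem melnikov_eq (hσ : A.IsCrossSection σ) (hlam : AnalyticAt ℝ lam 0) (hlam0 : lam 0 = 0)
    {n m : ℕ} (hm : 1 ≤ m) (hnm : n ≤ 3 * m) {B : ℝ → Fin 6 → ℝ} {u : ℝ → ℝ}
    (hB : ContinuousAt B 0) (hu : ContinuousAt u 0)
    (hl : ∀ᶠ ε in 𝓝 (0 : ℝ), lam ε = ε ^ n • B ε + (ε ^ m * u ε) • exactDir A.hamCase)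
    {h : ℝ} (hh : h ∈ A.levels) {γ : ℝ → ℝ × ℝ} {T : ℝ} (hγ : A.IsOvalParam h γ T) :
    melnikov A σ lam n h =
      ((linP A.hamCase (B 0)).eval h + 0 ^ (3 * m - n) * u 0 ^ 3 * (cubP A.hamCase).eval h) *
        ovalIntegral 2 γ T +
      ((linQ A.hamCase (B 0)).eval h + 0 ^ (3 * m - n) * u 0 ^ 3 * (cubQ A.hamCase).eval h) *
        ovalIntegral 0 γ T := by
  obtain ⟨τ, κ, Γ, hτ, hκ, hΓ, h0, hev⟩ := exists_return_arc hσ hlam hlam0 hh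
  have hd : ∀ᶠ ε in 𝓝 (0 : ℝ), displacement A σ (lam ε) h = κ ε - h :=
    hev.mono fun ε ⟨h1, h2, h3, h4, h5⟩ =>
      displacement_eq hσ (isDisplacement_of_isSol h1 h2 h3 h4 h5)
  set c := A.hamCase with hc
  have hσh : DifferentiableAt ℝ σ h := (hσ.1 h hh).differentiableAt
  have hσ1 : DifferentiableAt ℝ (fun k => (σ k).1) h := hσh.fst
  have hσ2 : DifferentiableAt ℝ (fun k => (σ k).2) h := hσh.snd
  set U : ℝ → ℝ := fun k => (σ k).1 * (σ k).2 ^ 3 with hU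
  set W : ℝ → ℝ := fun k => secondPrimitive c (σ k) with hW
  have dU : DifferentiableAt ℝ U h := hσ1.fun_mul (hσ2.fun_pow 3)
  have dW : DifferentiableAt ℝ W h := by
    simp only [hW, secondPrimitive]
    fun_prop
  have hκc : ContinuousAt κ 0 := hκ.continuousAt
  have cD1 : ContinuousAt (fun ε => dslope U h (κ ε)) 0 :=
    ContinuousAt.comp (g := dslope U h) (by rw [h0]; exact continuousAt_dslope_same.2 dU) hκc
  have cD2 : ContinuousAt (fun ε => dslope W h (κ ε)) 0 :=
    ContinuousAt.comp (g := dslope W h) (by rw [h0]; exact continuousAt_dslope_same.2 dW) hκc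
  set s : ℝ → ℝ := fun ε => ε ^ m * u ε with hs
  have cs : ContinuousAt s 0 := (continuousAt_id.pow m).mul hu
  have s0 : s 0 = 0 := by simp only [hs, zero_pow (by omega : m ≠ 0), zero_mul]
  -- The boundary terms of `IsSol.ham_sub_ham` are increments of F₁ and F₂ along σ, hence multiples
  -- of the displacement itself. Moved to the left they form the factor `D`, with D(0) = 1, so they
  -- do not affect the leading coefficient.
  set D : ℝ → ℝ := fun ε => 1 - s ε * dslope U h (κ ε) - s ε ^ 2 * dslope W h (κ ε) with hD
  have cD : ContinuousAt D 0 := (continuousAt_const.sub (cs.mul cD1)).sub ((cs.pow 2).mul cD2)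
  have D0 : D 0 = 1 := by simp [hD, s0]
  set N : ℝ → ℝ := fun ε =>
    τ ε * integral01 (dampPath (B ε) (Γ ε).1 (Γ ε).2 * (Γ ε).2 ^ 2 *
      (1 - (3 * s ε) • ((Γ ε).1 * (Γ ε).2) + s ε ^ 2 • cubicWeight c (Γ ε).1 (Γ ε).2)) +
    ε ^ (3 * m - n) * u ε ^ 3 * (τ ε * integral01 (cubicWeight c (Γ ε).1 (Γ ε).2 *
      (monoDeriv c (lam ε) 1 3 (Γ ε).1 (Γ ε).2 - (3 : ℝ) • ((Γ ε).1 * (Γ ε).2 *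
        (dampPath (lam ε) (Γ ε).1 (Γ ε).2 * (Γ ε).2 ^ 2))))) with hN
  have cτ : ContinuousAt τ 0 := hτ.continuousAt
  have cx : ContinuousAt (fun ε => (Γ ε).1) 0 := hΓ.continuousAt.fst
  have cy : ContinuousAt (fun ε => (Γ ε).2) 0 := hΓ.continuousAt.snd
  have cl : ∀ j, ContinuousAt (fun ε => lam ε j) 0 := continuousAt_pi.1 hlam.continuousAt
  have cB : ∀ j, ContinuousAt (fun ε => B ε j) 0 := continuousAt_pi.1 hB
  have cN : ContinuousAt N 0 := by
    simp only [hN, dampPath, cubicWeight, monoDeriv, fieldPath_eq]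
    have c0 := cl 0; have c1 := cl 1; have c2 := cl 2; have c3 := cl 3; have c4 := cl 4
    have c5 := cl 5
    have b0 := cB 0; have b1 := cB 1; have b2 := cB 2; have b3 := cB 3; have b4 := cB 4
    have b5 := cB 5
    fun_prop
  have key : ∀ᶠ ε in 𝓝 (0 : ℝ), displacement A σ (lam ε) h = ε ^ n * (N ε / D ε) := by
    filter_upwards [hev, hd, hl, cD.eventually_ne (by rw [D0]; exact one_ne_zero : D 0 ≠ 0)]
      with ε ⟨h1, h2, h3, h4, h5⟩ h6 h7 h8
    have hH := h3.ham_sub_ham h7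
    rw [h4, hσ.ham_eq h1, hσ.ham_eq hh, dampPath_smul, smul_mul_assoc, smul_mul_assoc, map_smul,
      smul_eq_mul] at hH
    have e1 : (κ ε - h) * dslope U h (κ ε) = U (κ ε) - U h := sub_smul_dslope U h (κ ε)
    have e2 : (κ ε - h) * dslope W h (κ ε) = W (κ ε) - W h := sub_smul_dslope W h (κ ε)
    have e3 : (ε ^ m) ^ 3 = ε ^ n * ε ^ (3 * m - n) := by
      rw [← pow_mul, ← pow_add]; congr 1; omega
    rw [h6, ← mul_div_assoc, eq_div_iff h8]
    simp only [hD, hN, hs] at *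
    simp only [hU] at e1
    simp only [hW] at e2
    linear_combination hH - (ε ^ m * u ε) * e1 - (ε ^ m * u ε) ^ 2 * e2 +
      u ε ^ 3 * (τ ε * integral01 (cubicWeight c (Γ ε).1 (Γ ε).2 *
      (monoDeriv c (lam ε) 1 3 (Γ ε).1 (Γ ε).2 - (3 : ℝ) • ((Γ ε).1 * (Γ ε).2 *
        (dampPath (lam ε) (Γ ε).1 (Γ ε).2 * (Γ ε).2 ^ 2))))) * e3
  -- Only continuity of N/D is available, `B` and `u` being merely continuous; the displacement
  -- itself is already known to be analytic.
  have hfin := taylorCoeff_of_eq_pow_mul (displacement_arc hσ hlam hlam0 hh).2.1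
    (cN.div₀ cD (by rw [D0]; exact one_ne_zero)) key
  obtain ⟨k1, k2, k3, k4, k5⟩ := hev.self_of_nhds
  rw [hlam0] at k3
  rw [h0] at k4
  have hS : pathEval (Γ 0) 1 ∈ σ '' A.levels := k4 ▸ ⟨h, hh, rfl⟩
  have hE : ∀ r, c.ham (pathEval (Γ 0) r) = h := fun r => by rw [k3.ham_eq r, hσ.ham_eq hh]
  have i1 := k3.integral_damp k2.ne' k4 hE (B 0)
  have i2 := k3.integral_cubic k2.ne' k4 hE
  rw [melnikov, hfin, D0, div_one, ovalIntegral_eq_of_isSol hσ hh k2 k3 hS k5 hγ,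
    ovalIntegral_eq_of_isSol hσ hh k2 k3 hS k5 hγ]
  simp only [hN, s0, hlam0, dampPath_zero, mul_zero, zero_mul, zero_smul, smul_zero, sub_zero,
    add_zero, mul_one, ne_eq, OfNat.ofNat_ne_zero, not_false_eq_true, zero_pow]
  rw [i1, i2]
  ring

/-- A relatively exact form has zero integral over every oval, so the `exactDir` component of the
coefficient vector is invisible at first order. -/
theorem eval_linP_sub_exactDir (c : HamCase) (l : Fin 6 → ℝ) (h : ℝ) :
    (linP c (l - l 2 • exactDir c)).eval h = (linP c l).eval h := by
  cases c <;> simp [linP, exactDir, HamCase.a, HamCase.b] <;> ring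

theorem eval_linQ_sub_exactDir (c : HamCase) (l : Fin 6 → ℝ) (h : ℝ) :
    (linQ c (l - l 2 • exactDir c)).eval h = (linQ c l).eval h := by
  cases c <;> simp [linQ, exactDir, HamCase.a, HamCase.b] <;> exact Or.inl (by ring)

/-- All polynomial coefficients vanish by independence of I_2 and I_0. The h² coefficient of the
first polynomial is a nonzero multiple of w; once w = 0, the other five equations cut out the line
of `exactDir`. -/
theorem eq_exactDir_of_integral_relation (hσ : A.IsCrossSection σ) {l : Fin 6 → ℝ} {w : ℝ}
    (hrel : ∀ h ∈ A.levels, ∀ γ T, A.IsOvalParam h γ T →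
      ((linP A.hamCase l).eval h + w * (cubP A.hamCase).eval h) * ovalIntegral 2 γ T +
        ((linQ A.hamCase l).eval h + w * (cubQ A.hamCase).eval h) * ovalIntegral 0 γ T = 0) :
    w = 0 ∧ ∀ j, l j = l 2 * exactDir A.hamCase j := by
  have key := fun p0 p1 p2 q0 q1 q2 => coeffs_eq_zero_of_integral_relation hσ (p0 := p0) (p1 := p1)
    (p2 := p2) (q0 := q0) (q1 := q1) (q2 := q2)
  generalize A.hamCase = c at *
  cases c with
  | globalCenter =>
    obtain ⟨e1, e2, e3, e4, e5, e6⟩ := key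
      (32 / 21 * l 5 - 40 / 231 * l 4 - 8 / 7 * l 3 - 3 / 7 * l 2 + l 1 - 8 / 1001 * 24 * w)
      (4 / 3 * l 5 - 320 / 231 * l 4 - 8 / 1001 * 181 * w) (-8 / 1001 * 308 * w) (l 0)
      (-16 / 21 * l 5 + 20 / 231 * l 4 + 4 / 7 * l 3 + 12 / 7 * l 2 + 8 / 1001 * 12 * w)
      (240 / 77 * l 4 + 8 / 1001 * 80 * w) (fun h hh γ T hγ => by
        have := hrel h hh γ T hγ
        simp [linP, linQ, cubP, cubQ] at this
        linear_combination this)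
    refine ⟨by linarith, fun j => ?_⟩
    fin_cases j <;> simp [exactDir, HamCase.a, HamCase.b] <;> linarith
  | truncatedPendulum =>
    obtain ⟨e1, e2, e3, e4, e5, e6⟩ := key
      (32 / 21 * l 5 + 40 / 231 * l 4 + 8 / 7 * l 3 - 3 / 7 * l 2 + l 1 - 8 / 1001 * 24 * w)
      (-(4 / 3 * l 5 + 320 / 231 * l 4) + 8 / 1001 * 181 * w) (-8 / 1001 * 308 * w) (l 0)
      (-(16 / 21 * l 5 + 20 / 231 * l 4 + 4 / 7 * l 3 - 12 / 7 * l 2) + 8 / 1001 * 12 * w)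
      (240 / 77 * l 4 - 8 / 1001 * 80 * w) (fun h hh γ T hγ => by
        have := hrel h hh γ T hγ
        simp [linP, linQ, cubP, cubQ] at this
        linear_combination this)
    refine ⟨by linarith, fun j => ?_⟩
    fin_cases j <;> simp [exactDir, HamCase.a, HamCase.b] <;> linarith
  | eightLoop =>
    obtain ⟨e1, e2, e3, e4, e5, e6⟩ := key
      (32 / 21 * l 5 + 40 / 231 * l 4 + 8 / 7 * l 3 + 3 / 7 * l 2 + l 1 - 8 / 1001 * 24 * w)
      (4 / 3 * l 5 + 320 / 231 * l 4 - 8 / 1001 * 181 * w) (-8 / 1001 * 308 * w) (l 0)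
      (16 / 21 * l 5 + 20 / 231 * l 4 + 4 / 7 * l 3 + 12 / 7 * l 2 - 8 / 1001 * 12 * w)
      (240 / 77 * l 4 - 8 / 1001 * 80 * w) (fun h hh γ T hγ => by
        have := hrel h hh γ T hγ
        simp [linP, linQ, cubP, cubQ] at this
        linear_combination this)
    refine ⟨by linarith, fun j => ?_⟩
    fin_cases j <;> simp [exactDir, HamCase.a, HamCase.b] <;> linarith

/-- The Taylor coefficients of order less than `n` point in the relatively exact direction, and
vanish up to order `n / 3`. -/
def IsExactBelow (c : HamCase) (lam : ℝ → Fin 6 → ℝ) (n : ℕ) : Prop :=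
  ∀ k < n, (∀ j, arcCoeff lam k j = arcCoeff lam k 2 * exactDir c j) ∧
    (3 * k < n → arcCoeff lam k 2 = 0)

theorem taylorCoeff_sub_mul {f g : ℝ → ℝ} (hf : AnalyticAt ℝ f 0) (hg : AnalyticAt ℝ g 0) (r : ℝ)
    (k : ℕ) : taylorCoeff (fun ε => f ε - g ε * r) k = taylorCoeff f k - taylorCoeff g k * r := by
  have h1 : iteratedDeriv k (fun ε => f ε - g ε * r) 0 =
      iteratedDeriv k f 0 - iteratedDeriv k (fun ε => g ε * r) 0 :=
    iteratedDeriv_fun_sub hf.contDiffAt (hg.fun_mul analyticAt_const).contDiffAt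
  have h2 : iteratedDeriv k (fun ε => g ε * r) 0 = iteratedDeriv k g 0 * r := by
    rw [iteratedDeriv_mul_const_field]
  rw [taylorCoeff, h1, h2, taylorCoeff, taylorCoeff]
  ring

theorem melnikov_eq_of_isExactBelow (hσ : A.IsCrossSection σ) (hlam : AnalyticAt ℝ lam 0)
    (hlam0 : lam 0 = 0) {n : ℕ} (hn : 1 ≤ n) (hex : IsExactBelow A.hamCase lam n)
    {h : ℝ} (hh : h ∈ A.levels) {γ : ℝ → ℝ × ℝ} {T : ℝ} (hγ : A.IsOvalParam h γ T) :
    melnikov A σ lam n h = (polyP A.hamCase lam n).eval h * ovalIntegral 2 γ T +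
      (polyQ A.hamCase lam n).eval h * ovalIntegral 0 γ T := by
  -- The least integer with n ≤ 3m; thus k < m means 3k < n, exactly the range where the third
  -- component is known to vanish.
  set m := (n + 2) / 3 with hm
  have ha : ∀ j, AnalyticAt ℝ (fun ε => lam ε j) 0 := analyticAt_pi_iff.1 hlam
  obtain ⟨u, hu, hlu, hu0⟩ := exists_eq_pow_mul (ha 2) (n := m) fun k hk =>
    (hex k (by omega)).2 (by omega)
  -- Subtracting the third component times `exactDir` removes all coefficients of order less than n,
  -- which permits division by ε^n.
  have hB : ∀ j, ∃ b, AnalyticAt ℝ b 0 ∧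
      (∀ᶠ ε in 𝓝 0, lam ε j - lam ε 2 * exactDir A.hamCase j = ε ^ n * b ε) ∧
      b 0 = arcCoeff lam n j - arcCoeff lam n 2 * exactDir A.hamCase j := fun j => by
    have := exists_eq_pow_mul ((ha j).fun_sub ((ha 2).fun_mul analyticAt_const)) (n := n)
      fun k hk => (taylorCoeff_sub_mul (ha j) (ha 2) (exactDir A.hamCase j) k).trans
        (sub_eq_zero.2 ((hex k hk).1 j))
    rwa [taylorCoeff_sub_mul (ha j) (ha 2) (exactDir A.hamCase j)] at this
  choose b hb hlb hb0 using hB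
  have hfin := melnikov_eq hσ hlam hlam0 (n := n) (m := m) (by omega) (by omega)
    (B := fun ε j => b j ε) (continuousAt_pi.2 fun j => (hb j).continuousAt) hu.continuousAt
    (by
      filter_upwards [hlu, eventually_all.2 hlb] with ε h1 h2
      rw [← h1]
      ext j
      simp only [Pi.add_apply, Pi.smul_apply, smul_eq_mul, ← h2]
      ring) hh hγ
  have hb' : (fun j => b j 0) = arcCoeff lam n - arcCoeff lam n 2 • exactDir A.hamCase :=
    funext hb0
  rw [hfin, hb', eval_linP_sub_exactDir, eval_linQ_sub_exactDir, hu0, polyP, polyQ]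
  split_ifs with h3
  · have e1 : 3 * m - n = 0 := by omega
    have e2 : n / 3 = m := by omega
    simp only [e1, e2, arcCoeff, pow_zero, one_mul, eval_add, eval_mul, eval_C]
  · have e1 : 3 * m - n ≠ 0 := by omega
    simp only [zero_pow e1, zero_mul, add_zero]

/-- If the coefficients of order less than `n` of the displacement function vanish, the deformation
is relatively exact below order `n`. -/
theorem isExactBelow_of_melnikov_eq_zero (hσ : A.IsCrossSection σ) (hlam : AnalyticAt ℝ lam 0)
    (hlam0 : lam 0 = 0) (n : ℕ)
    (hM : ∀ k, 1 ≤ k → k < n → ∀ h ∈ A.levels, melnikov A σ lam k h = 0) :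
    IsExactBelow A.hamCase lam n := by
  induction n with
  | zero => exact fun k hk => absurd hk (Nat.not_lt_zero k)
  | succ n ih =>
    have hn := ih fun k h1 h2 => hM k h1 (h2.trans n.lt_succ_self)
    rcases Nat.eq_zero_or_pos n with rfl | hpos
    · have hz : ∀ j, arcCoeff lam 0 j = 0 := fun j => by simp [arcCoeff, taylorCoeff, hlam0]
      intro k hk
      obtain rfl : k = 0 := by omega
      simp [hz]
    -- The vanishing of M_n gives both new facts: the coefficient of order n is along `exactDir`,
    -- and the cubic coefficient is 0 when 3 divides n.
    · obtain ⟨hw, hj⟩ := eq_exactDir_of_integral_relation hσ (l := arcCoeff lam n)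
        (w := if 3 ∣ n then arcCoeff lam (n / 3) 2 ^ 3 else 0) (fun h hh γ T hγ => by
          refine Eq.trans ?_ (hM n hpos n.lt_succ_self h hh)
          rw [melnikov_eq_of_isExactBelow hσ hlam hlam0 hpos hn hh hγ, polyP, polyQ]
          split_ifs <;> simp)
      intro k hk
      rcases Nat.lt_succ_iff_lt_or_eq.1 hk with hk | rfl
      · refine ⟨(hn k hk).1, fun h3 => ?_⟩
        rcases Nat.lt_succ_iff_lt_or_eq.1 h3 with h3 | h3
        · exact (hn k hk).2 h3
        -- The only new index is k = n/3, and there the cube of the third component has just been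
        -- shown to vanish.
        · rw [if_pos ⟨k, h3.symm⟩, ← h3, Nat.mul_div_cancel_left k three_pos] at hw
          exact pow_eq_zero_iff three_ne_zero |>.1 hw
      · exact ⟨hj, fun h3 => by omega⟩

end Arc

/-! ### Degree bounds and conclusion -/

theorem natDegree_linP_le (c : HamCase) (l : Fin 6 → ℝ) : (linP c l).natDegree ≤ 1 := by
  cases c <;> simp only [linP] <;> compute_degree

theorem natDegree_linQ_le (c : HamCase) (l : Fin 6 → ℝ) : (linQ c l).natDegree ≤ 2 := by
  cases c <;> simp only [linQ] <;> compute_degree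

theorem natDegree_cubP_le (c : HamCase) : (cubP c).natDegree ≤ 2 := by
  cases c <;> simp only [cubP] <;> compute_degree

theorem natDegree_cubQ_le (c : HamCase) : (cubQ c).natDegree ≤ 2 := by
  cases c <;> simp only [cubQ] <;> compute_degree

end

theorem theorem2 (A : PeriodAnnulus) (σ : ℝ → ℝ × ℝ) (hσ : A.IsCrossSection σ)
    (lam : ℝ → Fin 6 → ℝ) (hlam : AnalyticAt ℝ lam 0) (hlam0 : lam 0 = 0) :
    -- every oval is a periodic orbit
    (∀ h ∈ A.levels, ∃ γ T, A.IsOvalParam h γ T) ∧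
    -- the displacement function is well defined and expands as `M₁(h) ε + M₂(h) ε² + ⋯`
    (∀ h ∈ A.levels,
      (∀ᶠ ε in 𝓝 (0 : ℝ), ∃! δ, IsDisplacement A σ (lam ε) h δ) ∧
      AnalyticAt ℝ (fun ε => displacement A σ (lam ε) h) 0 ∧
      displacement A σ (lam 0) h = 0) ∧
    -- the first nonvanishing coefficient
    ∀ n : ℕ, 1 ≤ n →
      (∀ k, 1 ≤ k → k < n → ∀ h ∈ A.levels, melnikov A σ lam k h = 0) →
      (∀ h ∈ A.levels, ∀ γ T, A.IsOvalParam h γ T →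
        melnikov A σ lam n h =
          (polyP A.hamCase lam n).eval h * ovalIntegral 2 γ T +
          (polyQ A.hamCase lam n).eval h * ovalIntegral 0 γ T) ∧
      (3 ∣ n → (polyP A.hamCase lam n).natDegree ≤ 2 ∧ (polyQ A.hamCase lam n).natDegree ≤ 2) ∧
      (¬ 3 ∣ n → (polyP A.hamCase lam n).natDegree ≤ 1 ∧ (polyQ A.hamCase lam n).natDegree ≤ 2) := by
  refine ⟨fun h hh => exists_isOvalParam A hh, fun h hh => displacement_arc hσ hlam hlam0 hh,
    fun n hn hM => ⟨fun h hh γ T hγ => melnikov_eq_of_isExactBelow hσ hlam hlam0 hn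
      (isExactBelow_of_melnikov_eq_zero hσ hlam hlam0 n hM) hh hγ, fun h3 => ?_, fun h3 => ?_⟩⟩
  · rw [polyP, polyQ, if_pos h3, if_pos h3]
    exact ⟨natDegree_add_le_of_degree_le ((natDegree_linP_le _ _).trans one_le_two)
        ((natDegree_C_mul_le _ _).trans (natDegree_cubP_le _)),
      natDegree_add_le_of_degree_le (natDegree_linQ_le _ _)
        ((natDegree_C_mul_le _ _).trans (natDegree_cubQ_le _))⟩
  · rw [polyP, polyQ, if_neg h3, if_neg h3, add_zero, add_zero]
    exact ⟨natDegree_linP_le _ _, natDegree_linQ_le _ _⟩
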